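/- For a finite alphabet $\Sigma$ and a sequence $S\in\Sigma^\infty$ let $S_n$ be its prefix of length $n$. A finite-state gambler consists of a finite state set $Q$, a partial transition function $\delta:Q\times\Sigma\to Q\cup\{\bot\}$, a betting function $\beta$ assigning to each state a rational probability measure on $\Sigma$, and a start state. For $s\in[0,\infty)$ its $s$-gale is given by $d^{(s)}(\lambda)=1$ and $d^{(s)}(wa)=d^{(s)}(w)\cdot\beta(\delta(w))(a)\cdot|\Sigma|^s$, where $\delta(w)$ is the state after reading $w$ (and the bet is $0$ if $\delta(w)$ is undefined). The finite-state dimension $\dim_{FS}(S)$ is the infimum of all $s\ge 0$ for which some finite-state gambler satisfies $\limsup_{n\to\infty} d^{(s)}(S_n)=\infty$. A pushdown gambler has in addition a finite stack alphabet $\Gamma$, a stack start symbol $z\in\Gamma$, a partial transition function $\delta:Q\times\Gamma\times(\Sigma\cup\{\lambda\})\to(Q\times\Gamma^*)\cup\{\bot\}$ (the top stack symbol is replaced by a string) and a betting function $\beta$ on $Q\times\Gamma$ whose values are rational probability measures on $\Sigma$. It is deterministic (for all $q,a$, either $\delta(q,a,\lambda)=\bot$ or $\delta(q,a,b)=\bot$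 for all $b\in\Sigma$), and $z$ is never removed from the bottom (for all $q$ and $x\in\Sigma\cup\{\lambda\}$, $\delta(q,z,x)$ is $\bot$ or of the form $(q',vz)$). It starts with the stack $z$. Before each input character is bet on and read, $\lambda$-transitions are carried out as long as one is defined; they do not change the capital. Its $s$-gale is defined by the same recursion, where the bet is $\beta(q,t)$ for the state $q$ and the top stack symbol $t$ at the moment of betting (and the bet is $0$ if the configuration is undefined). The pushdown dimension $\dim_{PD}(S)$ is the infimum of all $s\ge0$ for which some pushdown gambler satisfies $\limsup_{n\to\infty} d^{(s)}(S_n)=\infty$. Let $d$ be a rational number with $0<d<1$. Call $A$ a block alphabet for $d$ of block length $l\geq 1$ if $A\subseteq\{0,1\}^l\setminus\{1^l\}$ and, for some integer $n\ge1$, $d=n/l$ and $|A|=2^n$. For $i\ge1$ let $\alpha_i\in A^*$ be the concatenation of all strings of length $i$ over $A$ in lexicographical order, let $c=1^l$, and let $C'$ be the infinite binary sequence $$C'=\alpha_1\,c\,\overline{\alpha_1}\;\alpha_2\alpha_2\,c\,\overline{\alpha_2\alpha_2}\;\alpha_3\alpha_3\alpha_3\,c\,\overline{\alpha_3\alpha_3\alpha_3}\cdots,$$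 where $\overline{w}$ denotes the reverse of $w$. Theorem. For every rational $0<d<1$ there is a block alphabet for $d$, and for every block alphabet $A$ for $d$ the binary sequence $C'$ constructed from it satisfies $$\dim_{FS}(C')=d\qquad\text{and}\qquad \dim_{PD}(C')\le\tfrac12\,\dim_{FS}(C'),$$ both dimensions being taken over the alphabet $\{0,1\}$. This holds both when $\overline{w}$ is the reverse of $w$ as a string over $A$ (the order of the blocks is reversed) and when it is the reverse of $w$ as a binary string (the order of the bits is reversed). -/

import Mathlib

open scoped NNReal ENNReal
open Filter

/-- A rational probability measure on a finite alphabet `σ`. -/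
structure RatProb (σ : Type) [Fintype σ] where
  prob : σ → ℚ≥0
  sum_prob : ∑ a, prob a = 1

/-- The prefix of length `n` of an infinite sequence. -/
def seqPrefix {σ : Type} (S : ℕ → σ) (n : ℕ) : List σ :=
  (List.range n).map S

/-! ### Finite-state gamblers and finite-state dimension -/

/-- A finite-state gambler with input alphabet `σ`; the value `none` of the transition
function means that the transition is undefined. -/
structure FSG (σ : Type) [Fintype σ] where
  Q : Type
  finQ : Finite Q
  δ : Q → σ → Option Q
  β : Q → RatProb σ
  q₀ : Q

namespace FSG

variable {σ : Type} [Fintype σ]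

/-- The state after reading the string `w` from the (possibly undefined) state `c`. -/
def stateFrom (G : FSG σ) (c : Option G.Q) (w : List σ) : Option G.Q :=
  w.foldl (fun c a => c.bind fun q => G.δ q a) c

/-- The amount bet on `a` in the (possibly undefined) state `c`; nothing if it is undefined. -/
def bet (G : FSG σ) : Option G.Q → σ → ℝ≥0
  | none, _ => 0
  | some q, a => ((G.β q).prob a : ℝ≥0)

/-- The `s`-gale of `G` when started in the (possibly undefined) state `c`. -/
noncomputable def sgaleFrom (G : FSG σ) (s : ℝ≥0) : Option G.Q → List σ → ℝ≥0
  | _, [] => 1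
  | c, a :: w =>
      G.bet c a * (Fintype.card σ : ℝ≥0) ^ (s : ℝ) * G.sgaleFrom s (c.bind fun q => G.δ q a) w

/-- The `s`-gale of `G`. -/
noncomputable def sgale (G : FSG σ) (s : ℝ≥0) (w : List σ) : ℝ≥0 :=
  G.sgaleFrom s (some G.q₀) w

theorem sgaleFrom_append_singleton (G : FSG σ) (s : ℝ≥0) (c : Option G.Q) (w : List σ) (a : σ) :
    G.sgaleFrom s c (w ++ [a]) =
      G.sgaleFrom s c w * G.bet (G.stateFrom c w) a * (Fintype.card σ : ℝ≥0) ^ (s : ℝ) := by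
  induction w generalizing c with
  | nil => simp [sgaleFrom, stateFrom]
  | cons b w ih =>
    simp only [List.cons_append, sgaleFrom, ih, stateFrom, List.foldl_cons]
    ring

/-- The usual recursion `d(wa) = d(w) · β(δ(w))(a) · |σ| ^ s` for the `s`-gale. -/
theorem sgale_append_singleton (G : FSG σ) (s : ℝ≥0) (w : List σ) (a : σ) :
    G.sgale s (w ++ [a]) =
      G.sgale s w * G.bet (G.stateFrom (some G.q₀) w) a * (Fintype.card σ : ℝ≥0) ^ (s : ℝ) :=
  G.sgaleFrom_append_singleton s (some G.q₀) w a

/-- `G` `s`-succeeds on `S`: the limsup of the `s`-gale along the prefixes of `S` is infinite. -/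
def Succeeds (G : FSG σ) (s : ℝ≥0) (S : ℕ → σ) : Prop :=
  limsup (fun n => (G.sgale s (seqPrefix S n) : ℝ≥0∞)) atTop = ⊤

end FSG

/-- Finite-state dimension: the infimum, in `[0, ∞]`, of the real `s ≥ 0` for which some
finite-state gambler `s`-succeeds on `S`. -/
noncomputable def dimFS {σ : Type} [Fintype σ] (S : ℕ → σ) : ℝ≥0∞ :=
  ⨅ (s : ℝ≥0) (_ : ∃ G : FSG σ, G.Succeeds s S), (s : ℝ≥0∞)

/-! ### Pushdown gamblers and pushdown dimension -/

/-- A pushdown gambler with input alphabet `σ`. The input `none` of the transition function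
stands for the empty string, and its value `none` means that the transition is undefined.
A stack is a list whose head is the top symbol; a transition replaces the top symbol by a string.
-/
structure PDG (σ : Type) [Fintype σ] where
  Q : Type
  finQ : Finite Q
  Γ : Type
  finΓ : Finite Γ
  δ : Q → Γ → Option σ → Option (Q × List Γ)
  β : Q → Γ → RatProb σ
  q₀ : Q
  z : Γ
  deterministic : ∀ q a, δ q a none = none ∨ ∀ b : σ, δ q a (some b) = none
  bottom : ∀ q x, δ q z x = none ∨ ∃ q' v, δ q z x = some (q', v ++ [z])

namespace PDG

variable {σ : Type} [Fintype σ]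

/-- A configuration: the state and the contents of the stack. -/
abbrev Config (P : PDG σ) : Type := P.Q × List P.Γ

/-- One transition on input `x`, where `x = none` is the empty string. -/
def step (P : PDG σ) (x : Option σ) : P.Config → Option P.Config
  | (_, []) => none
  | (q, a :: v) => (P.δ q a x).map fun r => (r.1, r.2 ++ v)

open Classical in
/-- Carry out transitions on the empty string as long as one is defined; undefined if this never
ends. -/
noncomputable def settle (P : PDG σ) (c : P.Config) : Option P.Config :=
  (StateTransition.eval (P.step none) c).toOption

/-- Read the input character `a` in a configuration in which no transition on the empty string is
defined, and then carry out the transitions on the empty string. -/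
noncomputable def read (P : PDG σ) (c : Option P.Config) (a : σ) : Option P.Config :=
  (c.bind (P.step (some a))).bind P.settle

/-- The configuration after reading the string `w` from the (possibly undefined) configuration
`c`. -/
noncomputable def configFrom (P : PDG σ) (c : Option P.Config) (w : List σ) : Option P.Config :=
  w.foldl P.read c

/-- The configuration of `P` in which the first character of the input is bet on. -/
noncomputable def start (P : PDG σ) : Option P.Config :=
  P.settle (P.q₀, [P.z])

/-- The amount bet on `a` in a (possibly undefined) configuration; it depends on the state and the
top of the stack. Nothing is bet in an undefined configuration. (The stack is never empty in a
configuration that is reached.) -/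
def bet (P : PDG σ) : Option P.Config → σ → ℝ≥0
  | some (q, t :: _), a => ((P.β q t).prob a : ℝ≥0)
  | _, _ => 0

/-- The `s`-gale of `P` when started in the (possibly undefined) configuration `c`. -/
noncomputable def sgaleFrom (P : PDG σ) (s : ℝ≥0) : Option P.Config → List σ → ℝ≥0
  | _, [] => 1
  | c, a :: w =>
      P.bet c a * (Fintype.card σ : ℝ≥0) ^ (s : ℝ) * P.sgaleFrom s (P.read c a) w

/-- The `s`-gale of `P`. -/
noncomputable def sgale (P : PDG σ) (s : ℝ≥0) (w : List σ) : ℝ≥0 :=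
  P.sgaleFrom s P.start w

theorem sgaleFrom_append_singleton (P : PDG σ) (s : ℝ≥0) (c : Option P.Config) (w : List σ)
    (a : σ) :
    P.sgaleFrom s c (w ++ [a]) =
      P.sgaleFrom s c w * P.bet (P.configFrom c w) a * (Fintype.card σ : ℝ≥0) ^ (s : ℝ) := by
  induction w generalizing c with
  | nil => simp [sgaleFrom, configFrom]
  | cons b w ih =>
    simp only [List.cons_append, sgaleFrom, ih, configFrom, List.foldl_cons]
    ring

/-- The usual recursion `d(wa) = d(w) · β(δ(w))(a) · |σ| ^ s` for the `s`-gale. -/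
theorem sgale_append_singleton (P : PDG σ) (s : ℝ≥0) (w : List σ) (a : σ) :
    P.sgale s (w ++ [a]) =
      P.sgale s w * P.bet (P.configFrom P.start w) a * (Fintype.card σ : ℝ≥0) ^ (s : ℝ) :=
  P.sgaleFrom_append_singleton s P.start w a

/-- `P` `s`-succeeds on `S`: the limsup of the `s`-gale along the prefixes of `S` is infinite. -/
def Succeeds (P : PDG σ) (s : ℝ≥0) (S : ℕ → σ) : Prop :=
  limsup (fun n => (P.sgale s (seqPrefix S n) : ℝ≥0∞)) atTop = ⊤

end PDG

/-- Pushdown dimension: the infimum, in `[0, ∞]`, of the real `s ≥ 0` for which some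
pushdown gambler `s`-succeeds on `S`. -/
noncomputable def dimPD {σ : Type} [Fintype σ] (S : ℕ → σ) : ℝ≥0∞ :=
  ⨅ (s : ℝ≥0) (_ : ∃ P : PDG σ, P.Succeeds s S), (s : ℝ≥0∞)

/-! ### The marked, mirrored Champernowne sequence

A string over a block alphabet `A` is a list of blocks, each block being a list of bits. -/

/-- All strings of `i` blocks over the alphabet `A`, in lexicographical order (`0 < 1`). -/
def lexStrings (A : Finset (List Bool)) : ℕ → List (List (List Bool))
  | 0 => [[]]
  | i + 1 => (A.sort (· ≤ ·)).flatMap fun a => (lexStrings A i).map fun w => a :: w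

/-- Membership in `lexStrings`. -/
theorem mem_lexStrings (A : Finset (List Bool)) (i : ℕ) (w : List (List Bool)) :
    w ∈ lexStrings A i ↔ w.length = i ∧ ∀ a ∈ w, a ∈ A := by
  induction i generalizing w with
  | zero => cases w <;> simp [lexStrings]
  | succ i ih => cases w <;> simp [lexStrings, ih] <;> tauto

/-- The strings in `lexStrings` are in strictly increasing lexicographical order. -/
theorem pairwise_lexStrings (A : Finset (List Bool)) (i : ℕ) :
    (lexStrings A i).Pairwise (· < ·) := by
  induction i with
  | zero => simp [lexStrings]
  | succ i ih =>
    rw [lexStrings, List.pairwise_flatMap]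
    refine ⟨fun a _ => ?_, ?_⟩
    · rw [List.pairwise_map]
      exact ih.imp fun h => List.Lex.cons h
    · refine (Finset.sortedLT_sort A).pairwise.imp fun {a b} hab x hx y hy => ?_
      simp only [List.mem_map] at hx hy
      obtain ⟨u, -, rfl⟩ := hx
      obtain ⟨v, -, rfl⟩ := hy
      exact List.Lex.rel hab

/-- `alphaPow A i` is `α_i ^ i`, where `α_i` is the concatenation of all strings of length `i` over
`A` in lexicographical order; it is given as a string over the alphabet `A`. -/
def alphaPow (A : Finset (List Bool)) (i : ℕ) : List (List Bool) :=
  (List.replicate i (lexStrings A i).flatten).flatten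

/-- The binary string of the reverse of `w`, where `w` is reversed as a string of blocks. -/
def reverseBlocks (w : List (List Bool)) : List Bool := w.reverse.flatten

/-- The reverse of the binary string of `w`, bit by bit. -/
def reverseBits (w : List (List Bool)) : List Bool := w.flatten.reverse

/-- The `i`-th stage `α_i^i c rev(α_i^i)` with the marker `c = 1^l`, as a binary string. -/
def stage (l : ℕ) (A : Finset (List Bool)) (rev : List (List Bool) → List Bool) (i : ℕ) :
    List Bool :=
  (alphaPow A i).flatten ++ List.replicate l true ++ rev (alphaPow A i)

/-- The concatenation of the first `k` stages, `i = 1, …, k`. -/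
def stages (l : ℕ) (A : Finset (List Bool)) (rev : List (List Bool) → List Bool) (k : ℕ) :
    List Bool :=
  (List.range k).flatMap fun j => stage l A rev (j + 1)

/-- The infinite binary sequence
`C' = α_1 c rev(α_1) α_2 α_2 c rev(α_2 α_2) α_3 α_3 α_3 c rev(α_3 α_3 α_3) …`
with `c = 1^l`. For `l ≥ 1` every stage is nonempty, so that bit `n` lies in the first `n + 1`
stages. -/
def markedChampernowne (l : ℕ) (A : Finset (List Bool)) (rev : List (List Bool) → List Bool) :
    ℕ → Bool :=
  fun n => (stages l A rev (n + 1)).getD n false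

theorem stages_succ (l : ℕ) (A : Finset (List Bool)) (rev : List (List Bool) → List Bool) (k : ℕ) :
    stages l A rev (k + 1) = stages l A rev k ++ stage l A rev (k + 1) := by
  simp [stages, List.range_succ]

theorem stages_prefix (l : ℕ) (A : Finset (List Bool)) (rev : List (List Bool) → List Bool)
    {j k : ℕ} (h : j ≤ k) : stages l A rev j <+: stages l A rev k := by
  induction h with
  | refl => exact List.prefix_refl _
  | step _ ih => exact ih.trans (stages_succ l A rev _ ▸ List.prefix_append _ _)

theorem le_length_stages {l : ℕ} (hl : 0 < l) (A : Finset (List Bool))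
    (rev : List (List Bool) → List Bool) (k : ℕ) : k ≤ (stages l A rev k).length := by
  induction k with
  | zero => simp
  | succ k ih =>
    rw [stages_succ]
    simp only [List.length_append, stage, List.length_replicate]
    omega

/-- The concatenation of the first `k` stages is a prefix of the sequence, for every `k`. -/
theorem seqPrefix_markedChampernowne {l : ℕ} (hl : 0 < l) (A : Finset (List Bool))
    (rev : List (List Bool) → List Bool) (k : ℕ) :
    seqPrefix (markedChampernowne l A rev) (stages l A rev k).length = stages l A rev k := by
  apply List.ext_getElem
  · simp [seqPrefix]
  · intro n h₁ h₂
    have h₃ : n < (stages l A rev (n + 1)).length := le_length_stages hl A rev (n + 1)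
    simp only [seqPrefix, List.getElem_map, List.getElem_range, markedChampernowne]
    rw [List.getD_eq_getElem _ _ h₃]
    rcases le_total (n + 1) k with h | h
    · exact (stages_prefix l A rev h).getElem h₃
    · exact ((stages_prefix l A rev h).getElem h₂).symm

/-- `A` is a block alphabet for the rational `d`: for some `n ≥ 1` and `l ≥ 1` with `d = n / l`,
`A ⊆ {0,1}^l \ {1^l}` and `log₂ |A| = n`. -/
def IsBlockAlphabet (d : ℚ) (l : ℕ) (A : Finset (List Bool)) : Prop :=
  0 < l ∧ (∀ a ∈ A, a.length = l ∧ a ≠ List.replicate l true) ∧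
    ∃ n : ℕ, 0 < n ∧ d = (n : ℚ) / (l : ℚ) ∧ A.card = 2 ^ n

/-! ### Growth bounds for the gale of a finite-state gambler -/

/-! Write `d = n / l` and `|A| = 2 ^ n`.

Lower bound for `dimFS`: the string `α_i` is a concatenation of `2 ^ (n * i)` distinct strings of `l
* i` bits. From a fixed state the bets on such strings sum to at most 1, so the inequality of the
means bounds the product of all bets along `α_i` in terms of the number of states
(`FSG.zero_gale_flatten_le`). If `s * l < n`, every pass over `α_i` with `i` large therefore loses
capital, and so does every pass over its mirror image, which also consists of distinct strings. The
`i` repetitions make the loss in stage `i` of order `i ^ 2 * 2 ^ (n * i)` in the exponent; this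
exceeds the largest temporary gain in the next stage, which is of order `i * 2 ^ (n * i)`, so the
gale stays bounded (`FSG.not_succeeds_markedChampernowne`).

Upper bounds: betting almost uniformly on `A` multiplies the capital by nearly `2 ^ (s * l) / 2 ^ n`
per block, and a small share of the uniform measure on all strings keeps the loss at the marker
bounded. A finite-state gambler thus wins for `s > d`. A pushdown gambler stores the first half of a
stage and predicts the second half with certainty; a block and its mirror image together earn nearly
`2 ^ (2 * s * l) / 2 ^ n`, which exceeds 1 for `s > d / 2`. The losses per stage are bounded while
the number of blocks grows (`limsup_eq_top_of_prod_le`).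

Both kinds of reversal are instances of `mirror g`, with `g` the identity or the reversal of a
block. -/

theorem List.prefix_or_exists_eq_append {α : Type*} {u v w : List α} (h : u <+: v ++ w) :
    u <+: v ∨ ∃ t, t <+: w ∧ u = v ++ t := by
  rcases List.prefix_or_prefix_of_prefix h (List.prefix_append v w) with h' | ⟨t, rfl⟩
  · exact Or.inl h'
  · exact Or.inr ⟨t, (List.prefix_append_right_inj v).1 h, rfl⟩

theorem RatProb.sum_prob_nnreal {σ : Type} [Fintype σ] (μ : RatProb σ) :
    ∑ a, (μ.prob a : ℝ≥0) = 1 := by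
  rw [← NNRat.cast_sum, μ.sum_prob, NNRat.cast_one]

theorem RatProb.prob_le_one {σ : Type} [Fintype σ] (μ : RatProb σ) (a : σ) :
    (μ.prob a : ℝ≥0) ≤ 1 := by
  rw [← μ.sum_prob_nnreal]
  exact Finset.single_le_sum (f := fun a => (μ.prob a : ℝ≥0)) (fun _ _ => zero_le) (Finset.mem_univ a)

namespace FSG

variable {σ : Type} [Fintype σ]

theorem bet_le_one (G : FSG σ) (c : Option G.Q) (a : σ) : G.bet c a ≤ 1 := by
  cases c with
  | none => simp [bet]
  | some q => exact (G.β q).prob_le_one a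

theorem sum_bet_le_one (G : FSG σ) (c : Option G.Q) : ∑ a, G.bet c a ≤ 1 := by
  cases c with
  | none => simp [bet]
  | some q => exact (G.β q).sum_prob_nnreal.le

theorem stateFrom_append (G : FSG σ) (c : Option G.Q) (u v : List σ) :
    G.stateFrom c (u ++ v) = G.stateFrom (G.stateFrom c u) v :=
  List.foldl_append

theorem sgaleFrom_append (G : FSG σ) (s : ℝ≥0) (c : Option G.Q) (u v : List σ) :
    G.sgaleFrom s c (u ++ v) = G.sgaleFrom s c u * G.sgaleFrom s (G.stateFrom c u) v := by
  induction u generalizing c with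
  | nil => simp [sgaleFrom, stateFrom]
  | cons a u ih => simp [sgaleFrom, stateFrom, ih, mul_assoc]

/-- Separates the bets from the growth factor: the 0-gale is the bare product of the bets. -/
theorem sgaleFrom_eq_zero_gale_mul (G : FSG σ) (s : ℝ≥0) (c : Option G.Q) (w : List σ) :
    G.sgaleFrom s c w = G.sgaleFrom 0 c w * ((Fintype.card σ : ℝ≥0) ^ (s : ℝ)) ^ w.length := by
  induction w generalizing c with
  | nil => simp [sgaleFrom]
  | cons a w ih =>
    simp only [sgaleFrom, ih (c.bind _), NNReal.coe_zero, NNReal.rpow_zero, List.length_cons]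
    ring

theorem zero_gale_le_one (G : FSG σ) (c : Option G.Q) (w : List σ) : G.sgaleFrom 0 c w ≤ 1 := by
  induction w generalizing c with
  | nil => simp [sgaleFrom]
  | cons a w ih =>
    simp only [sgaleFrom, NNReal.coe_zero, NNReal.rpow_zero, mul_one]
    exact mul_le_one' (G.bet_le_one c a) (ih _)

theorem sgaleFrom_le (G : FSG σ) (s : ℝ≥0) (c : Option G.Q) (w : List σ) :
    G.sgaleFrom s c w ≤ ((Fintype.card σ : ℝ≥0) ^ (s : ℝ)) ^ w.length := by
  rw [sgaleFrom_eq_zero_gale_mul]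
  exact mul_le_of_le_one_left' (G.zero_gale_le_one c w)

/-- Kraft's inequality: a gambler distributes its unit of capital over the strings of one length,
losing some where a transition is undefined. -/
theorem sum_ofFn_zero_gale_le_one (G : FSG σ) (K : ℕ) (c : Option G.Q) :
    ∑ f : Fin K → σ, G.sgaleFrom 0 c (List.ofFn f) ≤ 1 := by
  induction K generalizing c with
  | zero => simp [sgaleFrom]
  | succ K ih =>
    rw [← (Fin.consEquiv fun _ : Fin (K + 1) => σ).sum_comp, Fintype.sum_prod_type]
    calc ∑ a, ∑ f : Fin K → σ, G.sgaleFrom 0 c (List.ofFn (Fin.cons a f : Fin (K + 1) → σ))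
        = ∑ a, G.bet c a * ∑ f : Fin K → σ,
            G.sgaleFrom 0 (c.bind fun q => G.δ q a) (List.ofFn f) := by
          simp [List.ofFn_succ, sgaleFrom, Finset.mul_sum]
      _ ≤ ∑ a, G.bet c a := Finset.sum_le_sum fun a _ => mul_le_of_le_one_right' (ih _)
      _ ≤ 1 := G.sum_bet_le_one c

theorem sum_zero_gale_le_one (G : FSG σ) (c : Option G.Q) {K : ℕ} {W : List (List σ)}
    (hW : W.Nodup) (hK : ∀ w ∈ W, w.length = K) : (W.map (G.sgaleFrom 0 c)).sum ≤ 1 := by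
  classical
  rw [← List.sum_toFinset _ hW]
  refine le_trans ?_ (G.sum_ofFn_zero_gale_le_one K c)
  rw [← Finset.sum_image (f := fun w => G.sgaleFrom 0 c w) (g := fun f : Fin K → σ => List.ofFn f)
    fun _ _ _ _ h => List.ofFn_injective h]
  refine Finset.sum_le_sum_of_subset fun w hw => ?_
  obtain rfl := hK w (List.mem_toFinset.1 hw)
  exact Finset.mem_image.2 ⟨w.get, Finset.mem_univ _, List.ofFn_get w⟩

end FSG

/-- The inequality of arithmetic and geometric means for a list, relative to an upper bound of the
arithmetic mean. -/
theorem List.prod_map_le_pow_of_sum_le {α : Type*} (f : α → ℝ) (hf : ∀ a, 0 ≤ f a) (W : List α)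
    {x : ℝ} (hx : 0 < x) (h : (W.map f).sum ≤ W.length * x) : (W.map f).prod ≤ x ^ W.length := by
  -- The tangent inequality `y ≤ exp (y - 1)` at `y = f a / x`, multiplied over the list; the
  -- induction needs no hypothesis on the sum.
  have key : ∀ V : List α,
      (V.map f).prod ≤ x ^ V.length * Real.exp ((V.map f).sum / x - V.length) := by
    intro V
    induction V with
    | nil => simp
    | cons a V ih =>
      have h1 : f a ≤ x * Real.exp (f a / x - 1) := by
        have := Real.add_one_le_exp (f a / x - 1)
        rw [sub_add_cancel, div_le_iff₀ hx] at this
        linarith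
      have h2 : 0 ≤ (V.map f).prod := List.prod_nonneg (by simpa using fun a _ => hf a)
      simp only [List.map_cons, List.prod_cons, List.sum_cons, List.length_cons]
      calc f a * (V.map f).prod
          ≤ (x * Real.exp (f a / x - 1)) *
            (x ^ V.length * Real.exp ((V.map f).sum / x - V.length)) := by gcongr
        _ = x ^ (V.length + 1) *
            (Real.exp (f a / x - 1) * Real.exp ((V.map f).sum / x - V.length)) := by ring
        _ = _ := by
          rw [← Real.exp_add]
          congr 2
          push_cast
          ring
  refine (key W).trans (mul_le_of_le_one_right (pow_nonneg hx.le _) ?_)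
  rw [Real.exp_le_one_iff, sub_nonpos, div_le_iff₀ hx]
  exact h

namespace FSG

/-- Along a concatenation of `N` distinct strings of the same length, the bets of a gambler multiply
to at most `(M / N) ^ N`, where `M` is the number of its states, the undefined one included. -/
theorem zero_gale_flatten_le {σ : Type} [Fintype σ] (G : FSG σ) (c : Option G.Q) {K : ℕ}
    {W : List (List σ)} (hW : W.Nodup) (hK : ∀ w ∈ W, w.length = K) :
    (G.sgaleFrom 0 c W.flatten : ℝ) ≤ (Nat.card (Option G.Q) / W.length : ℝ) ^ W.length := by
  have := G.finQ
  have := Fintype.ofFinite (Option G.Q)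
  -- The state in which `w` is reached depends on what precedes it; summing over all states gives a
  -- bound that depends on `w` alone.
  set f : List σ → ℝ≥0 := fun w => ∑ c : Option G.Q, G.sgaleFrom 0 c w with hf
  have h1 : ∀ (V : List (List σ)) (c), G.sgaleFrom 0 c V.flatten ≤ (V.map f).prod := by
    intro V
    induction V with
    | nil => simp [sgaleFrom]
    | cons w V ih =>
      intro c
      rw [List.flatten_cons, sgaleFrom_append, List.map_cons, List.prod_cons]
      exact mul_le_mul' (Finset.single_le_sum (f := fun c => G.sgaleFrom 0 c w)
        (fun _ _ => zero_le) (Finset.mem_univ c)) (ih _)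
  have h2 : (W.map f).sum ≤ Nat.card (Option G.Q) := by
    -- After exchanging the sums, Kraft's inequality contributes at most 1 for each state.
    have : ∀ V : List (List σ),
        (V.map f).sum = ∑ c : Option G.Q, (V.map (G.sgaleFrom 0 c)).sum := by
      intro V
      induction V with
      | nil => simp
      | cons w V ih =>
        rw [List.map_cons, List.sum_cons, ih, ← Finset.sum_add_distrib]
        simp
    rw [this, Nat.card_eq_fintype_card]
    refine (Finset.sum_le_sum fun c _ => G.sum_zero_gale_le_one c hW hK).trans ?_
    simp
  rcases W.eq_nil_or_concat with rfl | hne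
  · simp [sgaleFrom]
  have hN : (0 : ℝ) < W.length := by
    obtain ⟨_, _, rfl⟩ := hne
    simp
    positivity
  have hM : (0 : ℝ) < Nat.card (Option G.Q) := by
    exact_mod_cast Nat.card_pos
  calc (G.sgaleFrom 0 c W.flatten : ℝ) ≤ ((W.map f).prod : ℝ≥0) := by exact_mod_cast h1 W c
    _ = (W.map fun w => (f w : ℝ)).prod := by
      rw [← NNReal.coe_toRealHom, map_list_prod, List.map_map]; rfl
    _ ≤ _ := by
      refine List.prod_map_le_pow_of_sum_le (fun w => (f w : ℝ))
        (fun w => (f w).coe_nonneg) W (div_pos hM hN) ?_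
      rw [mul_div_cancel₀ _ hN.ne']
      have : (W.map fun w => (f w : ℝ)).sum = ((W.map f).sum : ℝ≥0) := by
        rw [← NNReal.coe_toRealHom, map_list_sum, List.map_map]; rfl
      rw [this]
      exact_mod_cast h2

/-- From every state, reading `w` multiplies the `s`-gale by at most `2 ^ x`, and reading a prefix
of `w` by at most `2 ^ y`. -/
def GaleBound (G : FSG Bool) (s : ℝ≥0) (w : List Bool) (x y : ℝ) : Prop :=
  ∀ c, G.sgaleFrom s c w ≤ 2 ^ x ∧ ∀ u, u <+: w → G.sgaleFrom s c u ≤ 2 ^ y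

theorem GaleBound.mono {G : FSG Bool} {s : ℝ≥0} {w : List Bool} {x y x' y' : ℝ}
    (h : G.GaleBound s w x y) (hx : x ≤ x') (hy : y ≤ y') : G.GaleBound s w x' y' := fun c =>
  ⟨(h c).1.trans (NNReal.rpow_le_rpow_of_exponent_le one_le_two hx),
    fun u hu => ((h c).2 u hu).trans (NNReal.rpow_le_rpow_of_exponent_le one_le_two hy)⟩

/-- A prefix either ends inside `v` or consists of `v` and a prefix of `w`; in the second case a
negative `x` absorbs part of the excess `y'`. -/
theorem GaleBound.append {G : FSG Bool} {s : ℝ≥0} {v w : List Bool} {x y x' y' z : ℝ}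
    (hv : G.GaleBound s v x y) (hw : G.GaleBound s w x' y') (hy : y ≤ z) (hy' : x + y' ≤ z) :
    G.GaleBound s (v ++ w) (x + x') z := by
  intro c
  constructor
  · rw [sgaleFrom_append, NNReal.rpow_add two_ne_zero]
    exact mul_le_mul' (hv c).1 (hw _).1
  · intro u hu
    rcases List.prefix_or_exists_eq_append hu with h | ⟨t, ht, rfl⟩
    · exact ((hv.mono le_rfl hy) c).2 u h
    · rw [sgaleFrom_append]
      refine le_trans ?_ (NNReal.rpow_le_rpow_of_exponent_le one_le_two hy')
      rw [NNReal.rpow_add two_ne_zero]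
      exact mul_le_mul' (hv c).1 ((hw _).2 t ht)

/-- Since no copy increases the capital, the temporary excesses of the copies do not add up, while
the losses do. -/
theorem GaleBound.replicate {G : FSG Bool} {s : ℝ≥0} {w : List Bool} {x y : ℝ}
    (h : G.GaleBound s w x y) (hx : x ≤ 0) (hy : 0 ≤ y) (k : ℕ) :
    G.GaleBound s (List.replicate k w).flatten (k * x) y := by
  induction k with
  | zero =>
    intro c
    have : (1 : ℝ≥0) ≤ 2 ^ y := NNReal.one_le_rpow one_le_two hy
    simpa [sgaleFrom] using this
  | succ k ih =>
    rw [List.replicate_succ, List.flatten_cons]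
    convert! h.append ih le_rfl (by linarith) using 1
    push_cast
    ring

theorem galeBound_length (G : FSG Bool) (s : ℝ≥0) (w : List Bool) :
    G.GaleBound s w (s * w.length) (s * w.length) := by
  have h : ∀ c (u : List Bool), G.sgaleFrom s c u ≤ 2 ^ ((s : ℝ) * u.length) := by
    intro c u
    have := G.sgaleFrom_le s c u
    rwa [Fintype.card_bool, Nat.cast_ofNat, ← NNReal.rpow_natCast, ← NNReal.rpow_mul] at this
  refine fun c => ⟨h c w, fun u hu => (h c u).trans ?_⟩
  refine NNReal.rpow_le_rpow_of_exponent_le one_le_two ?_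
  have : (u.length : ℝ) ≤ w.length := by exact_mod_cast hu.length_le
  gcongr

/-- The growth bound along a concatenation of `2 ^ m` distinct strings of length `K`. -/
theorem galeBound_flatten (G : FSG Bool) (s : ℝ≥0) {K m : ℕ} {W : List (List Bool)}
    (hW : W.Nodup) (hK : ∀ w ∈ W, w.length = K) (hm : W.length = 2 ^ m) {t : ℝ}
    (ht : (Nat.card (Option G.Q) : ℝ) ≤ 2 ^ t) :
    G.GaleBound s W.flatten (2 ^ m * (s * K + t - m)) (s * K * 2 ^ m) := by
  have hlen : W.flatten.length = 2 ^ m * K := by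
    rw [List.length_flatten, List.map_eq_replicate_iff.2 hK]
    simp [hm]
  intro c
  have h0 := G.galeBound_length s W.flatten c
  rw [hlen] at h0
  constructor
  · have h1 := G.zero_gale_flatten_le c hW hK
    rw [hm] at h1
    rw [sgaleFrom_eq_zero_gale_mul, ← NNReal.coe_le_coe, hlen]
    push_cast
    rw [Fintype.card_bool]
    have h2 : ((Nat.card (Option G.Q) : ℝ) / ((2 ^ m : ℕ) : ℝ)) ≤ (2 : ℝ) ^ (t - m) := by
      rw [Real.rpow_sub two_pos, Real.rpow_natCast, Nat.cast_pow, Nat.cast_ofNat]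
      gcongr
    calc (G.sgaleFrom 0 c W.flatten : ℝ) * (((2 : ℕ) : ℝ) ^ (s : ℝ)) ^ (2 ^ m * K)
        ≤ ((2 : ℝ) ^ (t - m)) ^ (2 ^ m) * (((2 : ℕ) : ℝ) ^ (s : ℝ)) ^ (2 ^ m * K) := by
          gcongr
          exact h1.trans (pow_le_pow_left₀ (by positivity) h2 _)
      _ = 2 ^ ((2 : ℝ) ^ m * (s * K + t - m)) := by
          rw [← Real.rpow_natCast, ← Real.rpow_natCast, Nat.cast_ofNat, ← Real.rpow_mul two_pos.le,
            ← Real.rpow_mul two_pos.le, ← Real.rpow_add two_pos]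
          congr 1
          push_cast
          ring
  · intro u hu
    refine (h0.2 u hu).trans (NNReal.rpow_le_rpow_of_exponent_le one_le_two (le_of_eq ?_))
    push_cast
    ring

end FSG

/-! ### Strings of blocks and their mirror images -/

/-- The binary string of the reverse of a string of blocks, where each block is replaced by its
image under `g`. -/
def mirror (g : List Bool → List Bool) (w : List (List Bool)) : List Bool :=
  (w.reverse.map g).flatten

theorem reverseBlocks_eq_mirror : reverseBlocks = mirror id := by
  funext w
  simp [reverseBlocks, mirror]

theorem reverseBits_eq_mirror : reverseBits = mirror List.reverse := by
  funext w
  simp [reverseBits, mirror, List.reverse_flatten, List.map_reverse]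

theorem mirror_append (g : List Bool → List Bool) (u v : List (List Bool)) :
    mirror g (u ++ v) = mirror g v ++ mirror g u := by
  simp [mirror]

theorem mirror_flatten (g : List Bool → List Bool) (L : List (List (List Bool))) :
    mirror g L.flatten = (L.reverse.map (mirror g)).flatten := by
  induction L with
  | nil => simp [mirror]
  | cons w L ih => simp [mirror_append, ih]

theorem length_lexStrings (A : Finset (List Bool)) (i : ℕ) :
    (lexStrings A i).length = A.card ^ i := by
  induction i with
  | zero => simp [lexStrings]
  | succ i ih => simp [lexStrings, List.length_flatMap, ih, pow_succ, mul_comm]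

theorem nodup_lexStrings (A : Finset (List Bool)) (i : ℕ) : (lexStrings A i).Nodup :=
  (pairwise_lexStrings A i).imp fun h => h.ne

theorem mem_of_mem_alphaPow {A : Finset (List Bool)} {i : ℕ} {a : List Bool}
    (h : a ∈ alphaPow A i) : a ∈ A := by
  obtain ⟨u, hu, ha⟩ := List.mem_flatten.1 h
  rw [List.eq_of_mem_replicate hu] at ha
  obtain ⟨w, hw, ha⟩ := List.mem_flatten.1 ha
  exact ((mem_lexStrings A i w).1 hw).2 a ha

theorem le_length_alphaPow {A : Finset (List Bool)} (hA : A.Nonempty) (i : ℕ) :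
    i ≤ (alphaPow A i).length := by
  have h : (lexStrings A i).flatten.length = A.card ^ i * i := by
    rw [List.length_flatten, List.map_eq_replicate_iff.2 fun w hw => ((mem_lexStrings A i w).1 hw).1]
    simp [length_lexStrings]
  rcases Nat.eq_zero_or_pos i with rfl | hi
  · simp
  · simp only [alphaPow, List.length_flatten, List.map_replicate, List.sum_replicate, smul_eq_mul, h]
    have := Nat.pos_of_ne_zero (pow_ne_zero i hA.card_pos.ne')
    exact Nat.le_mul_of_pos_right _ (Nat.mul_pos this hi)

/-- Distinct strings of `i` blocks over `A` stay distinct as binary strings when their blocks are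
permuted and mapped injectively, without changing lengths. -/
theorem nodup_map_flatten_lexStrings {A : Finset (List Bool)} {l : ℕ} (hA : ∀ a ∈ A, a.length = l)
    (i : ℕ) {f : List (List Bool) → List (List Bool)} (hf : Function.Injective f)
    (hlen : ∀ w, ((f w).map List.length).Perm (w.map List.length)) :
    ((lexStrings A i).map fun w => (f w).flatten).Nodup ∧
      ∀ u ∈ (lexStrings A i).map fun w => (f w).flatten, u.length = l * i := by
  have h : ∀ w ∈ lexStrings A i, (f w).map List.length = List.replicate i l := by
    intro w hw
    obtain ⟨h1, h2⟩ := (mem_lexStrings A i w).1 hw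
    refine List.perm_replicate.1 ?_
    rw [← h1, ← List.map_eq_replicate_iff.2 fun a ha => hA a (h2 a ha)]
    exact hlen w
  constructor
  · refine List.Nodup.map_on (fun w hw w' hw' hww => hf ?_) (nodup_lexStrings A i)
    -- A list of blocks is determined by its concatenation and the lengths of its blocks.
    exact List.eq_iff_flatten_eq.2 ⟨hww, (h w hw).trans (h w' hw').symm⟩
  · simp only [List.mem_map]
    rintro _ ⟨w, hw, rfl⟩
    rw [List.length_flatten, h w hw]
    simp [mul_comm]

/-! ### The lower bound for the finite-state dimension -/

/-- One pass over `α_i` or its mirror image has exponent at most `2 ^ (n * i) * (s * l * i + δ * i -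
n * i) = -δ * i * 2 ^ (n * i)`, and there are `2 * i` passes. The marker contributes at most `s *
l`, and an unfinished pass at most `s * l * i * 2 ^ (n * i)`. -/
theorem FSG.galeBound_stage (G : FSG Bool) {s : ℝ≥0} {l n : ℕ} {A : Finset (List Bool)}
    (hA : ∀ a ∈ A, a.length = l) (hcard : A.card = 2 ^ n) {g : List Bool → List Bool}
    (hg : Function.Injective g) (hlen : ∀ a, (g a).length = a.length) {δ : ℝ} (hδ : 0 < δ)
    (hs : s * l + 2 * δ = n) {i : ℕ} (hi : (Nat.card (Option G.Q) : ℝ) ≤ 2 ^ (δ * i)) :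
    G.GaleBound s (stage l A (mirror g) i) (s * l - 2 * δ * i ^ 2 * 2 ^ (n * i))
      (s * l + s * l * i * 2 ^ (n * i)) := by
  have hN : (lexStrings A i).length = 2 ^ (n * i) := by
    rw [length_lexStrings, hcard, pow_mul]
  have hsl : (0 : ℝ) ≤ s * l := by positivity
  obtain ⟨h1, h1'⟩ := nodup_map_flatten_lexStrings hA i (f := id) Function.injective_id
    fun _ => List.Perm.refl _
  obtain ⟨h2, h2'⟩ := nodup_map_flatten_lexStrings hA i (f := fun w => w.reverse.map g)
    (hg.list_map.comp List.reverse_injective) fun w => by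
      rw [List.map_map, show List.length ∘ g = List.length from funext hlen]
      exact (List.reverse_perm w).map _
  have h2'' := List.nodup_reverse.2 h2
  have b1 := (G.galeBound_flatten s (m := n * i) h1 h1' (by simp [hN]) hi).mono
    (x' := -δ * i * 2 ^ (n * i)) (y' := s * l * i * 2 ^ (n * i))
    (by push_cast; rw [← hs]; ring_nf; rfl) (by push_cast; ring_nf; rfl)
  have b2 := (G.galeBound_flatten s (m := n * i) h2'' (by simpa using h2') (by simp [hN]) hi).mono
    (x' := -δ * i * 2 ^ (n * i)) (y' := s * l * i * 2 ^ (n * i))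
    (by push_cast; rw [← hs]; ring_nf; rfl) (by push_cast; ring_nf; rfl)
  have hneg : -δ * i * 2 ^ (n * i) ≤ 0 := by
    have : 0 ≤ δ * i * 2 ^ (n * i) := by positivity
    linarith
  have hy : (0 : ℝ) ≤ s * l * i * 2 ^ (n * i) := by positivity
  have hx : i * (-δ * i * 2 ^ (n * i)) ≤ 0 :=
    mul_nonpos_of_nonneg_of_nonpos (Nat.cast_nonneg _) hneg
  have b3 := (b1.replicate hneg hy i).append ((G.galeBound_length s (List.replicate l true)).append
    (b2.replicate hneg hy i) (z := s * l + s * l * i * 2 ^ (n * i))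
    (by simp only [List.length_replicate]; linarith)
    (by simp only [List.length_replicate]; linarith))
    (z := s * l + s * l * i * 2 ^ (n * i)) (by linarith) (by linarith)
  convert! b3.mono le_rfl le_rfl using 1
  · have e1 : (alphaPow A i).flatten = (List.replicate i
        ((lexStrings A i).map fun w => (id w).flatten).flatten).flatten := by
      simp [alphaPow, List.flatten_flatten]
    have e2 : mirror g (alphaPow A i) = (List.replicate i
        ((lexStrings A i).map fun w => (w.reverse.map g).flatten).reverse.flatten).flatten := by
      rw [alphaPow, mirror_flatten, List.reverse_replicate, List.map_replicate, mirror_flatten,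
        List.map_reverse]
      rfl
    rw [stage, e1, e2, List.append_assoc]
  · simp only [List.length_replicate]
    ring

theorem FSG.not_succeeds_of_le {σ : Type} [Fintype σ] {G : FSG σ} {s : ℝ≥0} {S : ℕ → σ} {C : ℝ≥0}
    (h : ∀ m, G.sgale s (seqPrefix S m) ≤ C) : ¬ G.Succeeds s S := by
  intro hs
  have : limsup (fun n => (G.sgale s (seqPrefix S n) : ℝ≥0∞)) atTop ≤ C :=
    limsup_le_of_le (h := Eventually.of_forall fun m => by exact_mod_cast h m)
  rw [FSG.Succeeds] at hs
  rw [hs] at this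
  exact ENNReal.coe_ne_top (top_le_iff.1 this)

theorem seqPrefix_prefix_stages {l : ℕ} (hl : 0 < l) (A : Finset (List Bool))
    (rev : List (List Bool) → List Bool) (m : ℕ) :
    seqPrefix (markedChampernowne l A rev) m <+: stages l A rev m := by
  rw [← seqPrefix_markedChampernowne hl A rev m]
  obtain ⟨r, hr⟩ := Nat.exists_eq_add_of_le (le_length_stages hl A rev m)
  rw [hr, seqPrefix, seqPrefix, List.range_add, List.map_append]
  exact List.prefix_append _ _

theorem FSG.not_succeeds_markedChampernowne (G : FSG Bool) {s : ℝ≥0} {l n : ℕ} (hl : 0 < l)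
    {A : Finset (List Bool)} (hA : ∀ a ∈ A, a.length = l) (hcard : A.card = 2 ^ n)
    {g : List Bool → List Bool} (hg : Function.Injective g) (hlen : ∀ a, (g a).length = a.length)
    (hs : s * l < (n : ℝ)) : ¬ G.Succeeds s (markedChampernowne l A (mirror g)) := by
  -- Half of the gap `n - s * l` pays for the number of states, the other half remains as loss.
  obtain ⟨δ, hδ, hsδ⟩ : ∃ δ : ℝ, 0 < δ ∧ s * l + 2 * δ = n :=
    ⟨(n - s * l) / 2, by linarith, by ring⟩
  have hsl : (0 : ℝ) ≤ s * l := by positivity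
  set τ : ℝ := s * l with hτ
  -- The second condition lets the loss of stage `i` cover the excess of stage `i + 1`: quadratic
  -- against linear growth in `i`. The summand 2 accounts for the markers of the two stages.
  obtain ⟨i₀, hi₀⟩ : ∃ i₀ : ℕ, ∀ i, i₀ ≤ i → (Nat.card (Option G.Q) : ℝ) ≤ 2 ^ (δ * i) ∧
      τ * (2 + (i + 1) * 2 ^ n) ≤ 2 * δ * i ^ 2 := by
    have hM : (0 : ℝ) < Nat.card (Option G.Q) := by
      have := G.finQ
      exact_mod_cast Nat.card_pos
    obtain ⟨a, ha⟩ := exists_nat_ge (Real.logb 2 (Nat.card (Option G.Q)) / δ)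
    obtain ⟨b, hb⟩ := exists_nat_ge (τ * (2 + 2 * 2 ^ n) / (2 * δ))
    refine ⟨a + b + 1, fun i hi => ?_⟩
    have hi1 : (a : ℝ) + b + 1 ≤ i := by exact_mod_cast hi
    have ha0 : (0 : ℝ) ≤ a := Nat.cast_nonneg a
    have hb0 : (0 : ℝ) ≤ b := Nat.cast_nonneg b
    constructor
    · rw [← Real.logb_le_iff_le_rpow one_lt_two hM]
      rw [div_le_iff₀ hδ] at ha
      nlinarith
    · rw [div_le_iff₀ (by positivity)] at hb
      have h2 : (0 : ℝ) < 2 ^ n := by positivity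
      calc τ * (2 + (i + 1) * 2 ^ n) ≤ τ * ((2 + 2 * 2 ^ n) * i) := by
            gcongr
            nlinarith
        _ = τ * (2 + 2 * 2 ^ n) * i := by ring
        _ ≤ (b * (2 * δ)) * i := by gcongr
        _ ≤ (i * (2 * δ)) * i := by
            gcongr
            linarith
        _ = _ := by ring
  -- The trivial bound for the first `i₀` stages plus the largest excess within stage `i₀ + 1`.
  set Y : ℝ := s * (stages l A (mirror g) i₀).length + τ + τ * (i₀ + 1) * 2 ^ (n * (i₀ + 1))
    with hY
  set e : ℕ → ℝ := fun j => τ - 2 * δ * j ^ 2 * 2 ^ (n * j) with he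
  have hstep : ∀ j, i₀ ≤ j → e j + (τ + τ * (j + 1) * 2 ^ (n * (j + 1))) ≤ 0 := by
    intro j hj
    have h1 := (hi₀ j hj).2
    have h2 : (1 : ℝ) ≤ 2 ^ (n * j) := one_le_pow₀ one_le_two
    have h3 : (2 : ℝ) ^ (n * (j + 1)) = 2 ^ n * 2 ^ (n * j) := by rw [← pow_add]; ring_nf
    rw [he, h3]
    nlinarith [mul_le_mul_of_nonneg_right h1 (zero_le_one.trans h2),
      mul_le_mul_of_nonneg_left h2 hsl]
  have hneg : ∀ j, i₀ ≤ j → e j ≤ 0 := by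
    intro j hj
    have := hstep j hj
    have : 0 ≤ τ + τ * (j + 1) * 2 ^ (n * (j + 1)) := by positivity
    linarith
  have hst : ∀ j, i₀ ≤ j →
      G.GaleBound s (stage l A (mirror g) j) (e j) (τ + τ * j * 2 ^ (n * j)) :=
    fun j hj => G.galeBound_stage hA hcard hg hlen hδ hsδ (hi₀ j hj).1
  -- Only the loss of the last stage is kept in the exponent; by `hstep` it suffices for the next
  -- excess, and the earlier ones are dropped by `hneg`.
  have hb : ∀ k, G.GaleBound s (stages l A (mirror g) (i₀ + k + 1))
      (Y - τ - τ * (i₀ + 1) * 2 ^ (n * (i₀ + 1)) + e (i₀ + k + 1)) Y := by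
    intro k
    have hτ1 : 0 ≤ τ * (i₀ + 1) * 2 ^ (n * (i₀ + 1)) := by positivity
    induction k with
    | zero =>
      rw [stages_succ]
      have h := hst (i₀ + 1) (by omega)
      push_cast at h
      refine ((G.galeBound_length s _).append h (z := Y) (by linarith) (by linarith)).mono ?_ le_rfl
      exact le_of_eq (by simp only [hY]; ring_nf)
    | succ k ih =>
      rw [stages_succ]
      have h := hst (i₀ + k + 1 + 1) (by omega)
      have h1 := hstep (i₀ + k + 1) (by omega)
      have h2 := hneg (i₀ + k + 1) (by omega)
      push_cast at h h1
      refine (ih.append h (z := Y) le_rfl (by linarith)).mono ?_ le_rfl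
      rw [← add_assoc i₀ k 1]
      linarith
  refine FSG.not_succeeds_of_le (C := 2 ^ Y) fun m => ?_
  refine (hb m (some G.q₀)).2 _ ((seqPrefix_prefix_stages hl A _ m).trans ?_)
  exact stages_prefix l A _ (by omega)

/-! ### Betting on blocks -/

/-- A positive rational probability measure on the binary strings of length `l`, given by the
probabilities of the cylinders. -/
structure BlockMeasure (l : ℕ) where
  weight : List Bool → ℚ≥0
  weight_pos : ∀ u, 0 < weight u
  weight_nil : weight [] = 1
  weight_split : ∀ u, u.length < l → weight (u ++ [true]) + weight (u ++ [false]) = weight u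

namespace BlockMeasure

variable {l : ℕ}

/-- The conditional distribution of the next bit after the beginning `u` of a block. -/
def cond (T : BlockMeasure l) (u : List Bool) (hu : u.length < l) : RatProb Bool where
  prob b := T.weight (u ++ [b]) / T.weight u
  sum_prob := by
    rw [Fintype.sum_bool, ← add_div, T.weight_split u hu, div_self (T.weight_pos u).ne']

/-- The mixture, with weights `p` and `q`, of the uniform measures on `A` and on all strings of
length `l`. -/
def mixture (A : Finset (List Bool)) (hA : ∀ a ∈ A, a.length = l) (hne : A.Nonempty) (p q : ℚ≥0)
    (hpq : p + q = 1) (hq : 0 < q) : BlockMeasure l where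
  -- The second summand keeps every cylinder positive, so the conditional probabilities exist and no
  -- block, in particular not the marker, ruins the gambler.
  weight u := p * ((A.filter (u <+: ·)).card / A.card) + q / 2 ^ u.length
  weight_pos u := by positivity
  weight_nil := by
    have : (A.card : ℚ≥0) ≠ 0 := by exact_mod_cast hne.card_pos.ne'
    simp [this, hpq]
  weight_split u hu := by
    have h : (A.filter (u <+: ·)).card =
        (A.filter (u ++ [true] <+: ·)).card + (A.filter (u ++ [false] <+: ·)).card := by
      rw [← Finset.card_union_of_disjoint]
      · congr 1
        ext a
        simp only [Finset.mem_filter, Finset.mem_union, ← and_or_left]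
        refine and_congr_right fun ha => ⟨?_, ?_⟩
        · rintro ⟨t, rfl⟩
          cases t with
          | nil =>
            have := hA _ ha
            simp only [List.append_nil] at this
            omega
          | cons b t => cases b <;> simp
        · rintro (h | h)
          · exact (List.prefix_append _ _).trans h
          · exact (List.prefix_append _ _).trans h
      · refine Finset.disjoint_filter.2 fun a _ h h' => ?_
        have := List.prefix_of_prefix_length_le h h' (by simp)
        simp at this
    rw [h]
    simp only [List.length_append, List.length_singleton, pow_succ, Nat.cast_add, add_div]
    have : q / 2 ^ u.length = q / (2 ^ u.length * 2) + q / (2 ^ u.length * 2) := by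
      field_simp
      norm_num
    rw [this]
    ring

variable {A : Finset (List Bool)} {hA : ∀ a ∈ A, a.length = l} {hne : A.Nonempty} {p q : ℚ≥0}
  {hpq : p + q = 1} {hq : 0 < q}

theorem le_weight_mixture_of_mem {a : List Bool} (ha : a ∈ A) :
    p / A.card ≤ (mixture A hA hne p q hpq hq).weight a := by
  have h1 : 1 ≤ (A.filter (a <+: ·)).card :=
    Finset.card_pos.2 ⟨a, Finset.mem_filter.2 ⟨ha, List.prefix_refl a⟩⟩
  have h2 : (1 : ℚ≥0) ≤ (A.filter (a <+: ·)).card := by exact_mod_cast h1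
  calc p / A.card = p * (1 / A.card) := by ring
    _ ≤ p * ((A.filter (a <+: ·)).card / A.card) := by gcongr
    _ ≤ _ := le_self_add

theorem le_weight_mixture (w : List Bool) :
    q / 2 ^ w.length ≤ (mixture A hA hne p q hpq hq).weight w :=
  le_add_self

end BlockMeasure

/-- Any slack `Z > 1` survives a small rational admixture: for `k * (Z - 1) > 1` the weight `p = k /
(k + 1)` works. -/
theorem exists_mixture_weights {Z : ℝ≥0} (hZ : 1 < Z) :
    ∃ p q : ℚ≥0, p + q = 1 ∧ 0 < q ∧ 1 < (p : ℝ≥0) * Z := by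
  have hZ' : (1 : ℝ) < Z := hZ
  obtain ⟨k, hk⟩ := exists_nat_gt (1 / ((Z : ℝ) - 1))
  rw [div_lt_iff₀ (by linarith)] at hk
  refine ⟨k / (k + 1), 1 / (k + 1), ?_, by positivity, ?_⟩
  · rw [← add_div, div_self (by positivity)]
  · rw [← NNReal.coe_lt_coe]
    push_cast
    rw [div_mul_eq_mul_div, lt_div_iff₀ (by positivity)]
    linarith

/-! ### A criterion for success -/

/-- The loss `P` per stage is constant while the gain `X ^ (j + 1)` grows, so from some stage on
each stage at least doubles the lower bound. -/
theorem limsup_eq_top_of_prod_le {l : ℕ} (hl : 0 < l) (A : Finset (List Bool))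
    (rev : List (List Bool) → List Bool) (f : List Bool → ℝ≥0) {P X : ℝ≥0} (hP : 0 < P)
    (hX : 1 < X)
    (h : ∀ k, ∏ j ∈ Finset.range k, P * X ^ (j + 1) ≤ f (stages l A rev k)) :
    limsup (fun n => (f (seqPrefix (markedChampernowne l A rev) n) : ℝ≥0∞)) atTop = ⊤ := by
  set a : ℕ → ℝ≥0 := fun k => ∏ j ∈ Finset.range k, P * X ^ (j + 1) with ha
  have hpos : ∀ k, 0 < a k := fun k =>
    Finset.prod_pos fun j _ => mul_pos hP (pow_pos (zero_lt_one.trans hX) _)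
  obtain ⟨k₀, hk₀⟩ := pow_unbounded_of_one_lt (2 / P) hX
  have hstep : ∀ t, 2 ^ t * a k₀ ≤ a (k₀ + t) := by
    intro t
    induction t with
    | zero => simp
    | succ t ih =>
      have h2 : 2 ≤ P * X ^ (k₀ + t + 1) := by
        rw [div_lt_iff₀ hP] at hk₀
        refine hk₀.le.trans ?_
        rw [mul_comm]
        gcongr
        · exact hX.le
        · omega
      rw [← add_assoc, ha]
      simp only []
      rw [Finset.prod_range_succ (n := k₀ + t), pow_succ]
      calc 2 ^ t * 2 * a k₀ = (2 ^ t * a k₀) * 2 := by ring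
        _ ≤ _ := mul_le_mul' ih h2
  refine ENNReal.eq_top_of_forall_nnreal_le fun r => ?_
  refine le_limsup_of_frequently_le (frequently_atTop.2 fun N => ?_) (by isBoundedDefault)
  obtain ⟨t, ht⟩ := pow_unbounded_of_one_lt (r / a k₀) (one_lt_two : (1 : ℝ≥0) < 2)
  refine ⟨(stages l A rev (k₀ + (t + N))).length,
    le_trans (by omega) (le_length_stages hl A rev _), ?_⟩
  rw [seqPrefix_markedChampernowne hl, ENNReal.coe_le_coe]
  refine le_trans ?_ (h _)
  rw [div_lt_iff₀ (hpos k₀)] at ht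
  refine ht.le.trans (le_trans ?_ (hstep _))
  gcongr
  · exact one_le_two
  · omega

/-! ### The upper bound for the finite-state dimension -/

/-- The gambler that bets on consecutive blocks according to one of two measures; after each block
it chooses the measure for the next one. -/
def blockGambler {l : ℕ} (hl : 0 < l) (T : Bool → BlockMeasure l)
    (next : Bool → List Bool → Bool) : FSG Bool where
  Q := Bool × {u : List Bool // u.length < l}
  finQ := by
    have : Finite {u : List Bool // u.length < l} := List.finite_length_lt Bool l
    infer_instance
  δ q b := some <|
    if h : (q.2.1 ++ [b]).length < l then (q.1, ⟨q.2.1 ++ [b], h⟩)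
    else (next q.1 (q.2.1 ++ [b]), ⟨[], hl⟩)
  β q := (T q.1).cond q.2.1 q.2.2
  q₀ := (true, ⟨[], hl⟩)

section blockGambler

variable {l : ℕ} (hl : 0 < l) (T : Bool → BlockMeasure l) (next : Bool → List Bool → Bool)

/-- The state of the gambler in mode `m` after the beginning `u` of a block. -/
def blockState (m : Bool) (u : {u : List Bool // u.length < l}) : (blockGambler hl T next).Q :=
  (m, u)

theorem blockGambler_δ (m : Bool) (u : {u : List Bool // u.length < l}) (b : Bool) :
    (blockGambler hl T next).δ (blockState hl T next m u) b =
      if h : (u.1 ++ [b]).length < l then some (blockState hl T next m ⟨u.1 ++ [b], h⟩)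
      else some (blockState hl T next (next m (u.1 ++ [b])) ⟨[], hl⟩) :=
  apply_dite some _ _ _

/-- The conditional probabilities telescope to a quotient of cylinder weights. The string `v` is
nonempty because its last bit completes the block and triggers the choice of the mode. -/
theorem blockGambler_partial (s : ℝ≥0) (m : Bool) (v : List Bool) (hv : v ≠ [])
    (u : {u : List Bool // u.length < l}) (huv : (u.1 ++ v).length = l) :
    (blockGambler hl T next).sgaleFrom s (some (blockState hl T next m u)) v =
        ((T m).weight (u ++ v) : ℝ≥0) / (T m).weight u * ((2 : ℝ≥0) ^ (s : ℝ)) ^ v.length ∧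
      (blockGambler hl T next).stateFrom (some (blockState hl T next m u)) v =
        some (blockState hl T next (next m (u ++ v)) ⟨[], hl⟩) := by
  induction v generalizing u with
  | nil => exact absurd rfl hv
  | cons b v ih =>
    have hb : (blockGambler hl T next).bet (some (blockState hl T next m u)) b =
        ((T m).weight (u ++ [b]) : ℝ≥0) / (T m).weight u := by
      simp [FSG.bet, blockGambler, blockState, BlockMeasure.cond]
    rw [FSG.sgaleFrom, hb, FSG.stateFrom, List.foldl_cons]
    rcases eq_or_ne v [] with rfl | hv'
    · have h : ¬ (u.1 ++ [b]).length < l := by omega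
      have hδ : ((some (blockState hl T next m u)).bind fun q => (blockGambler hl T next).δ q b) =
          some (blockState hl T next (next m (u.1 ++ [b])) ⟨[], hl⟩) := by
        rw [Option.bind_some, blockGambler_δ, dif_neg h]
      rw [hδ]
      simp [FSG.sgaleFrom]
    · have hlen : (u.1 ++ [b]).length + v.length = l := by
        simp only [List.length_append, List.length_cons] at huv ⊢
        simp only [List.length_nil]
        omega
      have h : (u.1 ++ [b]).length < l := by
        have := List.length_pos_iff.2 hv'
        omega
      have hδ : ((some (blockState hl T next m u)).bind fun q => (blockGambler hl T next).δ q b) =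
          some (blockState hl T next m ⟨u.1 ++ [b], h⟩) := by
        rw [Option.bind_some, blockGambler_δ, dif_pos h]
      obtain ⟨ih1, ih2⟩ := ih hv' ⟨u.1 ++ [b], h⟩ (by rwa [List.length_append])
      rw [FSG.stateFrom] at ih2
      rw [hδ, ih1, ih2]
      simp only [List.append_assoc, List.singleton_append, List.length_cons, and_true,
        Fintype.card_bool, Nat.cast_ofNat]
      have hpos : ((T m).weight (u.1 ++ [b]) : ℝ≥0) ≠ 0 := by
        exact_mod_cast ((T m).weight_pos _).ne'
      field_simp
      ring

theorem blockGambler_block (s : ℝ≥0) (m : Bool) {w : List Bool} (hw : w.length = l) :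
    (blockGambler hl T next).sgaleFrom s (some (blockState hl T next m ⟨[], hl⟩)) w =
        ((T m).weight w : ℝ≥0) * ((2 : ℝ≥0) ^ (s : ℝ)) ^ l ∧
      (blockGambler hl T next).stateFrom (some (blockState hl T next m ⟨[], hl⟩)) w =
        some (blockState hl T next (next m w) ⟨[], hl⟩) := by
  have := blockGambler_partial hl T next s m w (List.ne_nil_of_length_pos (by omega)) ⟨[], hl⟩
    (by simpa using hw)
  simpa [(T m).weight_nil, hw] using this

/-- On blocks from the set `A m` the gambler in mode `m` earns a factor `X` per block and stays in
its mode; in the other mode it loses at most one factor `P`. -/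
theorem blockGambler_run {s : ℝ≥0} {A : Bool → Finset (List Bool)} {P X : ℝ≥0}
    (hnext : ∀ m w, next m w = if w ∈ A m then m else !m) (hA : ∀ m, ∀ a ∈ A m, a.length = l)
    (hX : ∀ m, ∀ a ∈ A m, X ≤ ((T m).weight a : ℝ≥0) * ((2 : ℝ≥0) ^ (s : ℝ)) ^ l)
    (hP : ∀ m (w : List Bool), w.length = l →
      P * X ≤ ((T m).weight w : ℝ≥0) * ((2 : ℝ≥0) ^ (s : ℝ)) ^ l)
    (m : Bool) (w : List (List Bool)) (hw : ∀ a ∈ w, a ∈ A m) :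
    X ^ w.length ≤ (blockGambler hl T next).sgaleFrom s (some (blockState hl T next m ⟨[], hl⟩)) w.flatten ∧
    (blockGambler hl T next).stateFrom (some (blockState hl T next m ⟨[], hl⟩)) w.flatten =
      some (blockState hl T next m ⟨[], hl⟩) ∧
    (P ≤ 1 → ∀ m', P * X ^ w.length ≤
        (blockGambler hl T next).sgaleFrom s (some (blockState hl T next m' ⟨[], hl⟩)) w.flatten ∧
      ∃ m'', (blockGambler hl T next).stateFrom (some (blockState hl T next m' ⟨[], hl⟩)) w.flatten =
        some (blockState hl T next m'' ⟨[], hl⟩)) := by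
  induction w with
  | nil => exact ⟨by simp [FSG.sgaleFrom], rfl, fun h _ => ⟨by simpa [FSG.sgaleFrom], _, rfl⟩⟩
  | cons a w ih =>
    obtain ⟨ih1, ih2, ih3⟩ := ih fun b hb => hw b (List.mem_cons_of_mem _ hb)
    have ha := hw a List.mem_cons_self
    have hal := hA m a ha
    simp only [List.flatten_cons, FSG.sgaleFrom_append, FSG.stateFrom_append, List.length_cons]
    have key : X ^ (w.length + 1) ≤
          (blockGambler hl T next).sgaleFrom s (some (blockState hl T next m ⟨[], hl⟩)) a *
          (blockGambler hl T next).sgaleFrom s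
            ((blockGambler hl T next).stateFrom (some (blockState hl T next m ⟨[], hl⟩)) a) w.flatten ∧
        (blockGambler hl T next).stateFrom
          ((blockGambler hl T next).stateFrom (some (blockState hl T next m ⟨[], hl⟩)) a) w.flatten =
          some (blockState hl T next m ⟨[], hl⟩) := by
      obtain ⟨h1, h2⟩ := blockGambler_block hl T next s m hal
      rw [hnext, if_pos ha] at h2
      rw [h1, h2, pow_succ, mul_comm]
      exact ⟨mul_le_mul' (hX m a ha) ih1, ih2⟩
    refine ⟨key.1, key.2, fun hP1 m' => ?_⟩
    by_cases hm : m' = m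
    · rw [hm]
      exact ⟨(mul_le_of_le_one_left' hP1).trans key.1, m, key.2⟩
    · obtain ⟨h1, h2⟩ := blockGambler_block hl T next s m' hal
      rw [hnext] at h2
      rw [h1, h2, pow_succ]
      -- In the wrong mode, a block common to both sets still earns `X`. The first other block costs
      -- `P` and leads to the right mode, which is never left again.
      by_cases ha' : a ∈ A m'
      · rw [if_pos ha']
        refine ⟨?_, (ih3 hP1 m').2⟩
        calc P * (X ^ w.length * X) = X * (P * X ^ w.length) := by ring
          _ ≤ _ := mul_le_mul' (hX m' a ha') (ih3 hP1 m').1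
      · rw [if_neg ha']
        have hm' : (!m') = m := by cases m <;> cases m' <;> simp_all
        rw [hm']
        refine ⟨?_, m, ih2⟩
        calc P * (X ^ w.length * X) = (P * X) * X ^ w.length := by ring
          _ ≤ _ := mul_le_mul' (hP m' a hal) ih1

end blockGambler

theorem exists_fsg_succeeds_markedChampernowne {s : ℝ≥0} {l n : ℕ} (hl : 0 < l)
    {A : Finset (List Bool)} (hA : ∀ a ∈ A, a.length = l) (hcard : A.card = 2 ^ n)
    {g : List Bool → List Bool} (hg : Function.Injective g) (hlen : ∀ a, (g a).length = a.length)
    (hs : (n : ℝ) < s * l) : ∃ G : FSG Bool, G.Succeeds s (markedChampernowne l A (mirror g)) := by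
  set z : ℝ≥0 := ((2 : ℝ≥0) ^ (s : ℝ)) ^ l with hz
  have hz0 : 0 < z := by positivity
  have hZ : 1 < z / 2 ^ n := by
    rw [one_lt_div (by positivity), hz, ← NNReal.rpow_natCast, ← NNReal.rpow_natCast,
      ← NNReal.rpow_mul]
    exact NNReal.rpow_lt_rpow_of_exponent_lt one_lt_two hs
  obtain ⟨p, q, hpq, hq, hX1⟩ := exists_mixture_weights hZ
  set X : ℝ≥0 := p * (z / 2 ^ n) with hX
  have hX0 : 0 < X := zero_lt_one.trans hX1
  -- The second half of a stage consists of images under `g`, which need not lie in `A`; hence the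
  -- two modes.
  set B : Bool → Finset (List Bool) := fun m => if m then A else A.image g with hB
  have hBl : ∀ m, ∀ a ∈ B m, a.length = l := by
    rintro (_ | _) a ha
    · obtain ⟨b, hb, rfl⟩ := Finset.mem_image.1 (by simpa [hB] using ha : a ∈ A.image g)
      rw [hlen, hA b hb]
    · exact hA a (by simpa [hB] using ha)
  have hBc : ∀ m, (B m).card = 2 ^ n := by
    rintro (_ | _)
    · simp [hB, Finset.card_image_of_injective _ hg, hcard]
    · simp [hB, hcard]
  have hBne : ∀ m, (B m).Nonempty := fun m => Finset.card_pos.1 (by rw [hBc]; positivity)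
  set T : Bool → BlockMeasure l := fun m =>
    BlockMeasure.mixture (B m) (hBl m) (hBne m) p q hpq hq with hT
  set next : Bool → List Bool → Bool := fun m w => if w ∈ B m then m else !m with hnext
  -- The second argument makes `P * X` at most the earnings on an arbitrary block; the cap 1 is
  -- required by `blockGambler_run`.
  set P : ℝ≥0 := min 1 (q / 2 ^ l * z / X) with hP
  have hP0 : 0 < P := by
    have : (0 : ℝ≥0) < q := by exact_mod_cast hq
    exact lt_min one_pos (by positivity)
  have hTX : ∀ m, ∀ a ∈ B m, X ≤ ((T m).weight a : ℝ≥0) * z := by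
    intro m a ha
    have h := BlockMeasure.le_weight_mixture_of_mem (hA := hBl m) (hne := hBne m) (hpq := hpq)
      (hq := hq) ha
    have h' : ((p / (B m).card : ℚ≥0) : ℝ≥0) ≤ ((T m).weight a : ℝ≥0) := by exact_mod_cast h
    rw [hBc] at h'
    push_cast at h'
    calc X = p / 2 ^ n * z := by rw [hX]; ring
      _ ≤ _ := by gcongr
  have hTP : ∀ m (w : List Bool), w.length = l → P * X ≤ ((T m).weight w : ℝ≥0) * z := by
    intro m w hw
    have h := BlockMeasure.le_weight_mixture (hA := hBl m) (hne := hBne m) (hpq := hpq)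
      (hq := hq) w
    have h' : ((q / 2 ^ w.length : ℚ≥0) : ℝ≥0) ≤ ((T m).weight w : ℝ≥0) := by exact_mod_cast h
    rw [hw] at h'
    push_cast at h'
    calc P * X ≤ (q / 2 ^ l * z / X) * X := by gcongr; exact min_le_right _ _
      _ = q / 2 ^ l * z := div_mul_cancel₀ _ hX0.ne'
      _ ≤ _ := by gcongr
  -- Each stage costs at most three factors `P`: one for a wrong mode in each half, and one for the
  -- marker.
  refine ⟨blockGambler hl T next, limsup_eq_top_of_prod_le hl A _
    ((blockGambler hl T next).sgale s) (P := P ^ 3) (X := X) (by positivity) hX1 fun k => ?_⟩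
  suffices ∃ m, (blockGambler hl T next).stateFrom (some (blockGambler hl T next).q₀)
        (stages l A (mirror g) k) = some (blockState hl T next m ⟨[], hl⟩) ∧
      ∏ j ∈ Finset.range k, P ^ 3 * X ^ (j + 1) ≤
        (blockGambler hl T next).sgale s (stages l A (mirror g) k) from
    this.choose_spec.2
  induction k with
  | zero => exact ⟨true, rfl, by simp [stages, FSG.sgale, FSG.sgaleFrom]⟩
  | succ k ih =>
    obtain ⟨m, hm, ih⟩ := ih
    have hrun := blockGambler_run hl T next (s := s) (A := B) (P := P) (X := X) (fun _ _ => rfl)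
      hBl hTX hTP
    obtain ⟨r1, m₁, hm₁⟩ := (hrun true (alphaPow A (k + 1))
      fun a ha => by simpa [hB] using mem_of_mem_alphaPow ha).2.2 (min_le_left _ _) m
    obtain ⟨r2, hm₂⟩ := blockGambler_block hl T next s m₁ (w := List.replicate l true) (by simp)
    obtain ⟨r3, m₃, hm₃⟩ := (hrun false ((alphaPow A (k + 1)).reverse.map g) fun a ha => by
      obtain ⟨b, hb, rfl⟩ := List.mem_map.1 ha
      exact Finset.mem_image.2 ⟨b, mem_of_mem_alphaPow (List.mem_reverse.1 hb), rfl⟩).2.2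
        (min_le_left _ _) (next m₁ (List.replicate l true))
    have r2' := hTP m₁ (List.replicate l true) (by simp)
    rw [← r2] at r2'
    rw [stages_succ, Finset.prod_range_succ, FSG.sgale, FSG.sgaleFrom_append,
      FSG.stateFrom_append, hm, stage, FSG.sgaleFrom_append, FSG.sgaleFrom_append,
      FSG.stateFrom_append, FSG.stateFrom_append, hm₁, hm₂, mirror, hm₃]
    refine ⟨m₃, rfl, mul_le_mul' ih ?_⟩
    rw [List.length_map, List.length_reverse] at r3
    have hle : k + 1 ≤ (alphaPow A (k + 1)).length :=
      le_length_alphaPow (Finset.card_pos.1 (by rw [hcard]; positivity)) _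
    calc P ^ 3 * X ^ (k + 1) ≤ P ^ 3 * X ^ (alphaPow A (k + 1)).length := by
          gcongr
          exact hX1.le
      _ ≤ P ^ 3 * X ^ (alphaPow A (k + 1)).length * (X * X ^ (alphaPow A (k + 1)).length) :=
          le_mul_of_one_le_right' (one_le_mul hX1.le (one_le_pow₀ hX1.le))
      _ = P * X ^ (alphaPow A (k + 1)).length * (P * X) *
          (P * X ^ (alphaPow A (k + 1)).length) := by ring
      _ ≤ _ := mul_le_mul' (mul_le_mul' r1 r2') r3

/-! ### The upper bound for the pushdown dimension -/

namespace PDG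

theorem settle_eq_some {σ : Type} [Fintype σ] (P : PDG σ) (h : ∀ q t, P.δ q t none = none)
    (c : P.Config) : P.settle c = some c := by
  classical
  have hstep : P.step none c = none := by
    obtain ⟨q, _ | ⟨t, v⟩⟩ := c
    · rfl
    · simp [step, h]
  rw [settle, Part.toOption_eq_some_iff, StateTransition.mem_eval]
  exact ⟨Relation.ReflTransGen.refl, hstep⟩

theorem configFrom_append {σ : Type} [Fintype σ] (P : PDG σ) (c : Option P.Config)
    (u v : List σ) : P.configFrom c (u ++ v) = P.configFrom (P.configFrom c u) v :=
  List.foldl_append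

theorem sgaleFrom_append {σ : Type} [Fintype σ] (P : PDG σ) (s : ℝ≥0) (c : Option P.Config)
    (u v : List σ) :
    P.sgaleFrom s c (u ++ v) = P.sgaleFrom s c u * P.sgaleFrom s (P.configFrom c u) v := by
  induction u generalizing c with
  | nil => simp [sgaleFrom, configFrom]
  | cons a u ih => simp [sgaleFrom, configFrom, ih, mul_assoc]

end PDG

/-- The rational probability measure concentrated on one symbol. -/
def RatProb.dirac {σ : Type} [Fintype σ] [DecidableEq σ] (a : σ) : RatProb σ where
  prob b := if b = a then 1 else 0
  sum_prob := by simp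

/-- The effective state of the mirror gambler: `some u` after the beginning `u` of a block that will
be pushed, and `none` while the stack is read off. When the stack has been read off, the next block
begins. -/
def mirrorPhase {l : ℕ} (hl : 0 < l) :
    Option {u : List Bool // u.length < l} → Option Bool → Option {u : List Bool // u.length < l}
  | none, none => some ⟨[], hl⟩
  | none, some _ => none
  | some u, _ => some u

/-- The pushdown gambler that pushes the images under `g` of the blocks read, until the marker `1^l`
appears, and then bets everything on the bits on the stack. The stack start symbol is `none`. -/
def mirrorGambler {l : ℕ} (hl : 0 < l) (T : BlockMeasure l) (g : List Bool → List Bool) :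
    PDG Bool where
  Q := Option {u : List Bool // u.length < l}
  finQ := by
    have : Finite {u : List Bool // u.length < l} := List.finite_length_lt Bool l
    infer_instance
  Γ := Option Bool
  finΓ := inferInstance
  -- There are no transitions on the empty string: the return from popping to pushing is made by
  -- `mirrorPhase`, which sees the stack start symbol on top.
  δ q t x := x.map fun b =>
    match mirrorPhase hl q t with
    | none => (none, [])
    | some u =>
      if h : (u.1 ++ [b]).length < l then (some ⟨u.1 ++ [b], h⟩, [t])
      else if u.1 ++ [b] = List.replicate l true then (none, [t])
      -- Later blocks lie above earlier ones, so from the top the stack spells `mirror g` of the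
      -- blocks read.
      else (some ⟨[], hl⟩, (g (u.1 ++ [b])).map some ++ [t])
  β q t :=
    match mirrorPhase hl q t with
    -- The default `false` is never used: in this phase the top symbol is a bit.
    | none => RatProb.dirac (t.getD false)
    | some u => T.cond u.1 u.2
  q₀ := none
  z := none
  deterministic _ _ := Or.inl rfl
  bottom := by
    rintro q (_ | b)
    · exact Or.inl rfl
    · right
      cases q with
      | none =>
        simp only [mirrorPhase, Option.map_some, Option.some.injEq]
        split_ifs
        exacts [⟨_, [], rfl⟩, ⟨_, [], rfl⟩, ⟨_, _, rfl⟩]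
      | some u =>
        simp only [mirrorPhase, Option.map_some, Option.some.injEq]
        split_ifs
        exacts [⟨_, [], rfl⟩, ⟨_, [], rfl⟩, ⟨_, _, rfl⟩]

section mirrorGambler

variable {l : ℕ} (hl : 0 < l) (T : BlockMeasure l) (g : List Bool → List Bool)

/-- The configuration of the mirror gambler with the given state and stack. -/
def mirrorConfig (q : Option {u : List Bool // u.length < l}) (x : List (Option Bool)) :
    (mirrorGambler hl T g).Config :=
  (q, x)

theorem mirrorGambler_settle (c : (mirrorGambler hl T g).Config) :
    (mirrorGambler hl T g).settle c = some c :=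
  PDG.settle_eq_some _ (fun _ _ => rfl) c

theorem mirrorGambler_read_push {q : Option {u : List Bool // u.length < l}} {t : Option Bool}
    {u : {u : List Bool // u.length < l}} (hq : mirrorPhase hl q t = some u)
    (x : List (Option Bool)) (b : Bool) :
    (mirrorGambler hl T g).read (some (mirrorConfig hl T g q (t :: x))) b =
      some (if h : (u.1 ++ [b]).length < l then mirrorConfig hl T g (some ⟨u.1 ++ [b], h⟩) (t :: x)
        else if u.1 ++ [b] = List.replicate l true then mirrorConfig hl T g none (t :: x)
        else mirrorConfig hl T g (some ⟨[], hl⟩) ((g (u.1 ++ [b])).map some ++ t :: x)) := by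
  have h : (mirrorGambler hl T g).step (some b) (mirrorConfig hl T g q (t :: x)) =
      some (if h : (u.1 ++ [b]).length < l then mirrorConfig hl T g (some ⟨u.1 ++ [b], h⟩) (t :: x)
        else if u.1 ++ [b] = List.replicate l true then mirrorConfig hl T g none (t :: x)
        else mirrorConfig hl T g (some ⟨[], hl⟩) ((g (u.1 ++ [b])).map some ++ t :: x)) := by
    simp only [PDG.step, mirrorGambler, mirrorConfig, Option.map_some, hq]
    split_ifs
    · rfl
    · rfl
    · exact congrArg (fun y => some (_, y)) (List.append_assoc _ _ _)
  rw [PDG.read, Option.bind_some, h, Option.bind_some, mirrorGambler_settle]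

theorem mirrorGambler_bet_push {q : Option {u : List Bool // u.length < l}} {t : Option Bool}
    {u : {u : List Bool // u.length < l}} (hq : mirrorPhase hl q t = some u)
    (x : List (Option Bool)) (b : Bool) :
    (mirrorGambler hl T g).bet (some (mirrorConfig hl T g q (t :: x))) b =
      (T.weight (u ++ [b]) : ℝ≥0) / T.weight u := by
  simp [PDG.bet, mirrorGambler, mirrorConfig, hq, BlockMeasure.cond]

/-- The weights telescope as for the finite-state gambler. Assuming the phase rather than the state
also covers a block that begins in state `none` above an exhausted stack. -/
theorem mirrorGambler_partial (s : ℝ≥0) (v : List Bool) (hv : v ≠ [])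
    {q : Option {u : List Bool // u.length < l}} {t : Option Bool}
    {u : {u : List Bool // u.length < l}} (hq : mirrorPhase hl q t = some u)
    (x : List (Option Bool)) (huv : (u.1 ++ v).length = l) :
    (mirrorGambler hl T g).sgaleFrom s (some (mirrorConfig hl T g q (t :: x))) v =
        (T.weight (u ++ v) : ℝ≥0) / T.weight u * ((2 : ℝ≥0) ^ (s : ℝ)) ^ v.length ∧
      (mirrorGambler hl T g).configFrom (some (mirrorConfig hl T g q (t :: x))) v =
        some (if u.1 ++ v = List.replicate l true then mirrorConfig hl T g none (t :: x)
          else mirrorConfig hl T g (some ⟨[], hl⟩) ((g (u.1 ++ v)).map some ++ t :: x)) := by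
  induction v generalizing q u with
  | nil => exact absurd rfl hv
  | cons b v ih =>
    rw [PDG.sgaleFrom, mirrorGambler_bet_push hl T g hq, PDG.configFrom, List.foldl_cons,
      mirrorGambler_read_push hl T g hq]
    rcases eq_or_ne v [] with rfl | hv'
    · rw [dif_neg (by omega)]
      simp [PDG.sgaleFrom]
    · have hlen : (u.1 ++ [b]).length + v.length = l := by
        simp only [List.length_append, List.length_cons] at huv ⊢
        simp only [List.length_nil]
        omega
      have h : (u.1 ++ [b]).length < l := by
        have := List.length_pos_iff.2 hv'
        omega
      obtain ⟨ih1, ih2⟩ := ih hv' (q := some ⟨u.1 ++ [b], h⟩) rfl (by rwa [List.length_append])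
      rw [PDG.configFrom] at ih2
      rw [dif_pos h, ih1, ih2]
      simp only [List.append_assoc, List.singleton_append, List.length_cons, and_true,
        Fintype.card_bool, Nat.cast_ofNat]
      have hpos : (T.weight (u.1 ++ [b]) : ℝ≥0) ≠ 0 := by
        exact_mod_cast (T.weight_pos _).ne'
      field_simp
      ring

theorem mirrorGambler_block (s : ℝ≥0) {w : List Bool} (hw : w.length = l)
    {q : Option {u : List Bool // u.length < l}} {t : Option Bool}
    (hq : mirrorPhase hl q t = some ⟨[], hl⟩) (x : List (Option Bool)) :
    (mirrorGambler hl T g).sgaleFrom s (some (mirrorConfig hl T g q (t :: x))) w =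
        (T.weight w : ℝ≥0) * ((2 : ℝ≥0) ^ (s : ℝ)) ^ l ∧
      (mirrorGambler hl T g).configFrom (some (mirrorConfig hl T g q (t :: x))) w =
        some (if w = List.replicate l true then mirrorConfig hl T g none (t :: x)
          else mirrorConfig hl T g (some ⟨[], hl⟩) ((g w).map some ++ t :: x)) := by
  have := mirrorGambler_partial hl T g s w (List.ne_nil_of_length_pos (by omega)) hq x
    (by simpa using hw)
  simpa [T.weight_nil, hw] using this

/-- While a string of blocks other than the marker is read, its mirror image is pushed. -/
theorem mirrorGambler_run {s : ℝ≥0} {A : Finset (List Bool)} {X : ℝ≥0}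
    (hA : ∀ a ∈ A, a.length = l ∧ a ≠ List.replicate l true)
    (hX : ∀ a ∈ A, X ≤ (T.weight a : ℝ≥0) * ((2 : ℝ≥0) ^ (s : ℝ)) ^ l)
    (w : List (List Bool)) (hw : ∀ a ∈ w, a ∈ A)
    {q : Option {u : List Bool // u.length < l}} {t : Option Bool}
    (hq : mirrorPhase hl q t = some ⟨[], hl⟩) (x : List (Option Bool)) :
    X ^ w.length ≤
        (mirrorGambler hl T g).sgaleFrom s (some (mirrorConfig hl T g q (t :: x))) w.flatten ∧
      ∃ q' t' x', (mirror g w).map some ++ t :: x = t' :: x' ∧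
        mirrorPhase hl q' t' = some ⟨[], hl⟩ ∧
        (mirrorGambler hl T g).configFrom (some (mirrorConfig hl T g q (t :: x))) w.flatten =
          some (mirrorConfig hl T g q' (t' :: x')) := by
  induction w generalizing q t x with
  | nil => exact ⟨by simp [PDG.sgaleFrom], q, t, x, rfl, hq, rfl⟩
  | cons a w ih =>
    have ha := hw a List.mem_cons_self
    obtain ⟨h1, h2⟩ := mirrorGambler_block hl T g s (hA a ha).1 hq x
    rw [if_neg (hA a ha).2] at h2
    -- The top symbol is split off again because the induction hypothesis needs a stack with a
    -- visible top; this also covers an empty `g a`.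
    obtain ⟨t', x', htx⟩ : ∃ t' x', (g a).map some ++ t :: x = t' :: x' :=
      List.exists_cons_of_ne_nil (by simp)
    obtain ⟨ih1, q'', t'', x'', e1, e2, e3⟩ :=
      ih (fun b hb => hw b (List.mem_cons_of_mem _ hb)) (q := some ⟨[], hl⟩) (t := t') rfl x'
    rw [List.flatten_cons, PDG.sgaleFrom_append, PDG.configFrom_append, h1, h2, htx,
      List.length_cons, pow_succ, mul_comm]
    refine ⟨mul_le_mul' (hX a ha) ih1, q'', t'', x'', ?_, e2, e3⟩
    rw [← e1, ← htx, ← List.singleton_append, mirror_append]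
    simp [mirror]

/-- The bits on the stack are predicted with certainty. -/
theorem mirrorGambler_pop (s : ℝ≥0) (v : List Bool) (x : List (Option Bool)) :
    (mirrorGambler hl T g).sgaleFrom s (some (mirrorConfig hl T g none (v.map some ++ x))) v =
        ((2 : ℝ≥0) ^ (s : ℝ)) ^ v.length ∧
      (mirrorGambler hl T g).configFrom (some (mirrorConfig hl T g none (v.map some ++ x))) v =
        some (mirrorConfig hl T g none x) := by
  induction v with
  | nil => simp [PDG.sgaleFrom, PDG.configFrom]
  | cons b v ih =>
    have hb : (mirrorGambler hl T g).bet
        (some (mirrorConfig hl T g none (some b :: (v.map some ++ x)))) b = 1 := by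
      simp [PDG.bet, mirrorGambler, mirrorConfig, mirrorPhase, RatProb.dirac]
    have hr : (mirrorGambler hl T g).read
        (some (mirrorConfig hl T g none (some b :: (v.map some ++ x)))) b =
        some (mirrorConfig hl T g none (v.map some ++ x)) := by
      have h : (mirrorGambler hl T g).step (some b)
          (mirrorConfig hl T g none (some b :: (v.map some ++ x))) =
          some (mirrorConfig hl T g none (v.map some ++ x)) := rfl
      rw [PDG.read, Option.bind_some, h, Option.bind_some, mirrorGambler_settle]
    rw [PDG.configFrom] at ih
    rw [List.map_cons, List.cons_append, PDG.sgaleFrom, PDG.configFrom, List.foldl_cons, hb, hr,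
      ih.1, ih.2, List.length_cons, pow_succ, mul_comm]
    simp

end mirrorGambler

/-- With `z = 2 ^ (s * l)`, a block of the first half earns at least `p * z / 2 ^ n`, possibly a
loss, and its mirror image earns the full `z`. The product exceeds 1 for `p` close to 1, because `n
< 2 * s * l`. Only the marker costs a further constant factor per stage. -/
theorem exists_pdg_succeeds_markedChampernowne {s : ℝ≥0} {l n : ℕ} (hl : 0 < l)
    {A : Finset (List Bool)} (hA : ∀ a ∈ A, a.length = l ∧ a ≠ List.replicate l true)
    (hcard : A.card = 2 ^ n) {g : List Bool → List Bool} (hlen : ∀ a, (g a).length = a.length)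
    (hs : (n : ℝ) < 2 * s * l) :
    ∃ P : PDG Bool, P.Succeeds s (markedChampernowne l A (mirror g)) := by
  set z : ℝ≥0 := ((2 : ℝ≥0) ^ (s : ℝ)) ^ l with hz
  have hz0 : 0 < z := by positivity
  have hZ : 1 < z * z / 2 ^ n := by
    rw [one_lt_div (by positivity), hz, ← NNReal.rpow_natCast, ← NNReal.rpow_natCast,
      ← NNReal.rpow_mul, ← NNReal.rpow_add two_ne_zero]
    exact NNReal.rpow_lt_rpow_of_exponent_lt one_lt_two (by linarith)
  obtain ⟨p, q, hpq, hq, hX1⟩ := exists_mixture_weights hZ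
  have hne : A.Nonempty := Finset.card_pos.1 (by rw [hcard]; positivity)
  have hAl : ∀ a ∈ A, a.length = l := fun a ha => (hA a ha).1
  set T := BlockMeasure.mixture A hAl hne p q hpq hq with hT
  have hq' : (0 : ℝ≥0) < q := by exact_mod_cast hq
  have hTX : ∀ a ∈ A, p / 2 ^ n * z ≤ (T.weight a : ℝ≥0) * z := by
    intro a ha
    have h := BlockMeasure.le_weight_mixture_of_mem (hA := hAl) (hne := hne) (hpq := hpq)
      (hq := hq) ha
    have h' : ((p / A.card : ℚ≥0) : ℝ≥0) ≤ (T.weight a : ℝ≥0) := by exact_mod_cast h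
    rw [hcard] at h'
    push_cast at h'
    gcongr
  have hTP : q / 2 ^ l * z ≤ (T.weight (List.replicate l true) : ℝ≥0) * z := by
    have h := BlockMeasure.le_weight_mixture (hA := hAl) (hne := hne) (hpq := hpq)
      (hq := hq) (List.replicate l true)
    have h' : ((q / 2 ^ (List.replicate l true).length : ℚ≥0) : ℝ≥0) ≤
      (T.weight (List.replicate l true) : ℝ≥0) := by exact_mod_cast h
    rw [List.length_replicate] at h'
    push_cast at h'
    gcongr
  have hmirror : ∀ w : List (List Bool), (∀ a ∈ w, a ∈ A) → (mirror g w).length = l * w.length := by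
    intro w hw
    rw [mirror, List.length_flatten, List.map_map,
      List.map_eq_replicate_iff.2 fun a ha =>
        show (List.length ∘ g) a = l from (hlen a).trans (hAl a (hw a (List.mem_reverse.1 ha)))]
    simp [mul_comm]
  refine ⟨mirrorGambler hl T g, limsup_eq_top_of_prod_le hl A _ ((mirrorGambler hl T g).sgale s)
    (P := q / 2 ^ l * z) (X := p * (z * z / 2 ^ n)) (by positivity) hX1 fun k => ?_⟩
  have hstart : (mirrorGambler hl T g).start = some (mirrorConfig hl T g none [none]) :=
    mirrorGambler_settle hl T g _
  -- Each stage ends with exactly the stack start symbol left, so the stages can be treated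
  -- independently.
  suffices (mirrorGambler hl T g).configFrom (mirrorGambler hl T g).start
        (stages l A (mirror g) k) = some (mirrorConfig hl T g none [none]) ∧
      ∏ j ∈ Finset.range k, q / 2 ^ l * z * (p * (z * z / 2 ^ n)) ^ (j + 1) ≤
        (mirrorGambler hl T g).sgale s (stages l A (mirror g) k) from this.2
  induction k with
  | zero => exact ⟨hstart, by simp [stages, PDG.sgale, PDG.sgaleFrom]⟩
  | succ k ih =>
    obtain ⟨hc, ih⟩ := ih
    set w := alphaPow A (k + 1) with hw
    have hwA : ∀ a ∈ w, a ∈ A := fun a ha => mem_of_mem_alphaPow ha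
    obtain ⟨r1, q', t', x', e1, e2, e3⟩ := mirrorGambler_run hl T g hA hTX w hwA
      (q := none) (t := none) rfl []
    obtain ⟨r2, e4⟩ := mirrorGambler_block hl T g s (w := List.replicate l true) (by simp) e2 x'
    rw [if_pos rfl] at e4
    obtain ⟨r3, e5⟩ := mirrorGambler_pop hl T g s (mirror g w) [none]
    rw [hmirror w hwA, pow_mul, e1] at r3
    rw [e1] at e5
    rw [stages_succ, Finset.prod_range_succ, PDG.sgale, PDG.sgaleFrom_append,
      PDG.configFrom_append, hc, stage, ← hw, PDG.sgaleFrom_append, PDG.sgaleFrom_append,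
      PDG.configFrom_append, PDG.configFrom_append, e3, e4, e5, r2, r3]
    refine ⟨rfl, mul_le_mul' ih ?_⟩
    have hle : k + 1 ≤ w.length := le_length_alphaPow hne _
    calc q / 2 ^ l * z * (p * (z * z / 2 ^ n)) ^ (k + 1)
        ≤ q / 2 ^ l * z * (p * (z * z / 2 ^ n)) ^ w.length := by
          gcongr
          exact hX1.le
      _ = (p / 2 ^ n * z) ^ w.length * (q / 2 ^ l * z) * z ^ w.length := by
          rw [show p * (z * z / 2 ^ n) = p / 2 ^ n * z * z by ring, mul_pow]
          ring
      _ ≤ _ := mul_le_mul' (mul_le_mul' r1 hTP) le_rfl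

/-! ### The dimensions of the marked Champernowne sequence -/

/-- Take `n / l` in lowest terms. As `n < l`, at least `2 ^ n` strings of length `l` remain after
`1^l` is removed. -/
theorem exists_isBlockAlphabet {d : ℚ} (hd0 : 0 < d) (hd1 : d < 1) :
    ∃ (l : ℕ) (A : Finset (List Bool)), IsBlockAlphabet d l A := by
  set n := d.num.toNat with hn
  have hnum : 0 < d.num := Rat.num_pos.2 hd0
  have hn0 : 0 < n := by omega
  have hnl : n < d.den := by
    have := Rat.num_lt_denom_iff.2 hd1
    omega
  set B : Finset (List Bool) := Finset.univ.image fun f : Fin d.den → Bool => List.ofFn f with hB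
  have hBcard : B.card = 2 ^ d.den := by
    rw [hB, Finset.card_image_of_injective _ List.ofFn_injective]
    simp
  have h1 : 2 ^ n ≤ (B.erase (List.replicate d.den true)).card := by
    have h2 := Finset.pred_card_le_card_erase (s := B) (a := List.replicate d.den true)
    have h3 : 2 ^ n < 2 ^ d.den := Nat.pow_lt_pow_right one_lt_two hnl
    omega
  obtain ⟨A, hAB, hA⟩ := Finset.exists_subset_card_eq h1
  refine ⟨d.den, A, d.den_pos, fun a ha => ?_, n, hn0, ?_, hA⟩
  · obtain ⟨h2, h3⟩ := Finset.mem_erase.1 (hAB ha)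
    obtain ⟨f, -, rfl⟩ := Finset.mem_image.1 h3
    exact ⟨by simp, h2⟩
  · have : ((n : ℤ) : ℚ) = d.num := by rw [hn, Int.toNat_of_nonneg hnum.le]
    rw [Int.cast_natCast] at this
    rw [this, Rat.num_div_den]

/-- The values `r + ε` suffice for the infimum, so success at the threshold `r` itself is not
needed. -/
theorem iInf_coe_nnreal_le {p : ℝ≥0 → Prop} {r : ℝ} (hr : 0 ≤ r)
    (h : ∀ s : ℝ≥0, r < s → p s) : ⨅ (s : ℝ≥0) (_ : p s), (s : ℝ≥0∞) ≤ ENNReal.ofReal r := by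
  lift r to ℝ≥0 using hr
  rw [ENNReal.ofReal_coe_nnreal]
  refine ENNReal.le_of_forall_pos_le_add fun ε hε _ => ?_
  rw [← ENNReal.coe_add]
  exact iInf₂_le (r + ε) (h _ (by exact_mod_cast lt_add_of_pos_right r hε))

theorem dims_markedChampernowne {l n : ℕ} (hl : 0 < l) {A : Finset (List Bool)}
    (hA : ∀ a ∈ A, a.length = l ∧ a ≠ List.replicate l true) (hcard : A.card = 2 ^ n)
    {g : List Bool → List Bool} (hg : Function.Injective g)
    (hlen : ∀ a, (g a).length = a.length) :
    dimFS (markedChampernowne l A (mirror g)) = ENNReal.ofReal (n / l : ℝ) ∧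
      dimPD (markedChampernowne l A (mirror g)) ≤ ENNReal.ofReal (n / l / 2 : ℝ) := by
  have hl' : (0 : ℝ) < l := by exact_mod_cast hl
  have hAl : ∀ a ∈ A, a.length = l := fun a ha => (hA a ha).1
  refine ⟨le_antisymm ?_ ?_, ?_⟩
  · refine iInf_coe_nnreal_le (by positivity) fun s hs => ?_
    rw [div_lt_iff₀ hl'] at hs
    exact exists_fsg_succeeds_markedChampernowne hl hAl hcard hg hlen hs
  -- A successful gambler with `s < n / l` would contradict the boundedness of its gale.
  · refine le_iInf₂ fun s ⟨G, hG⟩ => ?_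
    by_contra hlt
    rw [not_le, ENNReal.lt_ofReal_iff_toReal_lt ENNReal.coe_ne_top, ENNReal.coe_toReal,
      lt_div_iff₀ hl'] at hlt
    exact G.not_succeeds_markedChampernowne hl hAl hcard hg hlen hlt hG
  · refine iInf_coe_nnreal_le (by positivity) fun s hs => ?_
    rw [div_lt_iff₀ two_pos, div_lt_iff₀ hl'] at hs
    exact exists_pdg_succeeds_markedChampernowne hl hA hcard hlen (by linarith)

theorem mainTheorem1 (d : ℚ) (hd0 : 0 < d) (hd1 : d < 1) :
    (∃ (l : ℕ) (A : Finset (List Bool)), IsBlockAlphabet d l A) ∧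
    ∀ (l : ℕ) (A : Finset (List Bool)), IsBlockAlphabet d l A →
      ∀ rev : List (List Bool) → List Bool, (rev = reverseBlocks ∨ rev = reverseBits) →
        dimFS (markedChampernowne l A rev) = ENNReal.ofReal (d : ℝ) ∧
        dimPD (markedChampernowne l A rev) ≤
          (1 / 2 : ℝ≥0∞) * dimFS (markedChampernowne l A rev) := by
  refine ⟨exists_isBlockAlphabet hd0 hd1, ?_⟩
  rintro l A ⟨hl, hA, n, -, hd, hcard⟩ rev hrev
  obtain ⟨g, hg, hlen, rfl⟩ : ∃ g : List Bool → List Bool, Function.Injective g ∧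
      (∀ a, (g a).length = a.length) ∧ rev = mirror g := by
    rcases hrev with rfl | rfl
    · exact ⟨id, Function.injective_id, fun _ => rfl, reverseBlocks_eq_mirror⟩
    · exact ⟨List.reverse, List.reverse_injective, fun _ => List.length_reverse,
        reverseBits_eq_mirror⟩
  obtain ⟨h1, h2⟩ := dims_markedChampernowne hl hA hcard hg hlen
  have hd' : (d : ℝ) = n / l := by rw [hd]; push_cast; rfl
  rw [h1, hd']
  refine ⟨rfl, h2.trans (le_of_eq ?_)⟩
  rw [ENNReal.ofReal_div_of_pos two_pos, ENNReal.ofReal_ofNat, one_div, mul_comm, div_eq_mul_inv]
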